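/- Let $s\ge 2$ and let $A$ be an $s\times s$ matrix with entries in $\{0,1\}$ which is irreducible (for all $i,j$ there is $n\ge1$ with $A^n(i,j)>0$) and aperiodic (for every $i$, $\gcd\{n\ge 1: A^n(i,i)>0\}=1$; this holds in particular if $A(i,i)=1$ for all $i$). Let $$\Sigma_A^+=\{x\in\{1,\dots,s\}^{\mathbb N_0}: A(x_n,x_{n+1})=1\ \forall n\ge0\},\qquad \Sigma_A=\{x\in\{1,\dots,s\}^{\mathbb Z}: A(x_n,x_{n+1})=1\ \forall n\in\mathbb Z\},$$ with the shift $(\sigma x)_n=x_{n+1}$. Fix $\theta>1$ and put $d_\theta(x,y)=\theta^{-t(x,y)}$, where $t(x,y)=\sup\{n\ge0: x_i=y_i \text{ for } 0\le i<n\}$ on $\Sigma_A^+$, and $t(x,y)=\sup\{n\ge0: x_i=y_i\text{ for } |i|<n\}$ on $\Sigma_A$ (with $\theta^{-\infty}=0$). For a real function $g$ that is Lipschitz with respect to $d_\theta$ let $$|g|_\theta=\sup_{n\ge0}\frac{\operatorname{var}_n g}{\theta^{-n}},\qquad \operatorname{var}_n g=\sup\{|g(x)-g(y)|: t(x,y)\ge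 n\},$$ which is the least Lipschitz constant of $g$. Let $\lambda$ be the largest eigenvalue of $A$, and let $u$ and $v$ be strictly positive left and right eigenvectors of $A$ for $\lambda$ with $\sum_i u_iv_i=1$. Let $m$ be the Parry measure on $\Sigma_A^+$, respectively $\Sigma_A$, i.e. the stationary Markov measure with probability vector $p_i=u_iv_i$ and transition matrix $p_{ij}=A(i,j)v_j/(\lambda v_i)$. Let $h_\mu(\sigma)$ denote the Kolmogorov–Sinai entropy of a $\sigma$-invariant Borel probability measure $\mu$. Then there is a constant $c>0$ (depending only on $A$ and $\theta$) such that for every $\sigma$-invariant Borel probability measure $\mu$ on $\Sigma_A^+$ and every Lipschitz function $f:\Sigma_A^+\to\mathbb R$, $$\left|\int f\,d\mu-\int f\,dm\right|\le c\,|f|_\theta\,\bigl(h_m(\sigma)-h_\mu(\sigma)\bigr)^{1/2}.$$ The same holds, with a constant $c>0$ depending only on $A$ and $\theta$, for the two-sided shift $(\Sigma_A,\sigma)$. -/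

import Mathlib

open MeasureTheory Filter

noncomputable section

/-! ### Subshifts of finite type -/

/-- The one-sided subshift of finite type: one-sided sequences all of whose transitions are allowed
by the 0-1 matrix `A`. As a subtype of `ℕ → Fin s` it carries the product `σ`-algebra, which is the
Borel `σ`-algebra of the product topology. -/
def OneSidedShift {s : ℕ} (A : Matrix (Fin s) (Fin s) ℝ) : Set (ℕ → Fin s) :=
  {x | ∀ n, A (x n) (x (n + 1)) = 1}

/-- The two-sided subshift of finite type. -/
def TwoSidedShift {s : ℕ} (A : Matrix (Fin s) (Fin s) ℝ) : Set (ℤ → Fin s) :=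
  {x | ∀ n, A (x n) (x (n + 1)) = 1}

/-- The shift map `(σ x) n = x (n + 1)` on one-sided sequences. -/
def oneSidedShiftMap {s : ℕ} (A : Matrix (Fin s) (Fin s) ℝ) (x : OneSidedShift A) :
    OneSidedShift A :=
  ⟨fun n => x.1 (n + 1), fun n => x.2 (n + 1)⟩

/-- The shift map `(σ x) n = x (n + 1)` on two-sided sequences. -/
def twoSidedShiftMap {s : ℕ} (A : Matrix (Fin s) (Fin s) ℝ) (x : TwoSidedShift A) :
    TwoSidedShift A :=
  ⟨fun n => x.1 (n + 1), fun n => x.2 (n + 1)⟩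

/-- A nonnegative square matrix is aperiodic if every index has period one, i.e. the lengths of
the closed paths through it have greatest common divisor `1`. -/
def IsAperiodicMatrix {s : ℕ} (A : Matrix (Fin s) (Fin s) ℝ) : Prop :=
  ∀ i, Nat.setGcd {n : ℕ | 0 < n ∧ 0 < (A ^ n) i i} = 1

/-! ### The metric `d_θ`, Lipschitz functions and the seminorm `|·|_θ`

The relation `agree n x y` says that `x` and `y` have the same central block of order `n`. -/

/-- One-sided agreement: `x i = y i` for `0 ≤ i < n`. -/
def oneSidedAgree {s : ℕ} (A : Matrix (Fin s) (Fin s) ℝ) (n : ℕ) (x y : OneSidedShift A) : Prop :=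
  ∀ i : ℕ, i < n → x.1 i = y.1 i

/-- Two-sided agreement: `x i = y i` for `|i| < n`. -/
def twoSidedAgree {s : ℕ} (A : Matrix (Fin s) (Fin s) ℝ) (n : ℕ) (x y : TwoSidedShift A) : Prop :=
  ∀ i : ℤ, |i| < (n : ℤ) → x.1 i = y.1 i

open Classical in
/-- The metric `d_θ(x, y) = θ ^ (-t(x, y))`, where `t(x, y)` is the largest `n` such that `x` and
`y` agree to order `n`; it is `0` when `x = y`. -/
def symbolicDist {X : Type*} (agree : ℕ → X → X → Prop) (θ : ℝ) (x y : X) : ℝ :=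
  if x = y then 0 else (θ ^ sSup {n : ℕ | agree n x y})⁻¹

/-- `g` is Lipschitz with respect to `d_θ`. -/
def IsSymbolicLipschitz {X : Type*} (agree : ℕ → X → X → Prop) (θ : ℝ) (g : X → ℝ) : Prop :=
  ∃ L : ℝ, ∀ x y, |g x - g y| ≤ L * symbolicDist agree θ x y

/-- `var_n g = sup { |g x - g y| : x and y agree to order n }`. -/
def symbolicVar {X : Type*} (agree : ℕ → X → X → Prop) (g : X → ℝ) (n : ℕ) : ℝ :=
  sSup {r : ℝ | ∃ x y, agree n x y ∧ r = |g x - g y|}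

/-- `|g|_θ = sup { var_n g / θ ^ (-n) : n ≥ 0 }`, the least Lipschitz constant of `g` with respect
to `d_θ`. -/
def symbolicSeminorm {X : Type*} (agree : ℕ → X → X → Prop) (θ : ℝ) (g : X → ℝ) : ℝ :=
  ⨆ n : ℕ, symbolicVar agree g n / (θ ^ n)⁻¹

/-! ### Kolmogorov–Sinai entropy

A finite measurable partition of `X` is given by a measurable labelling `ξ : X → Fin k`; its
members are the sets `ξ ⁻¹' {i}`. -/

/-- Shannon entropy `-∑ μ(C) log μ(C)` of the partition of `X` into the fibres of `ξ`. -/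
def partitionEntropy {X ι : Type*} [MeasurableSpace X] [Fintype ι] (μ : Measure X) (ξ : X → ι) :
    ℝ :=
  ∑ i, Real.negMulLog (μ.real (ξ ⁻¹' {i}))

/-- The join of the partitions `ξ, T⁻¹ ξ, …, T^{-(n-1)} ξ`. -/
def partitionJoin {X ι : Type*} (T : X → X) (ξ : X → ι) (n : ℕ) : X → (Fin n → ι) :=
  fun x i => ξ (T^[i] x)

/-- The entropy of `T` with respect to the partition `ξ`: the limit as `n → ∞` of `1 / n` times
the entropy of the join of `ξ, …, T^{-(n-1)} ξ`. For invariant probability measures the limit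
exists, so that it is the upper limit. -/
def entropyOfPartition {X ι : Type*} [MeasurableSpace X] [Fintype ι] (T : X → X) (μ : Measure X)
    (ξ : X → ι) : ENNReal :=
  limsup (fun n : ℕ => ENNReal.ofReal (partitionEntropy μ (partitionJoin T ξ n) / n)) atTop

/-- The Kolmogorov–Sinai entropy `h_μ(T)`: the supremum over all finite measurable partitions. -/
def measureEntropy {X : Type*} [MeasurableSpace X] (T : X → X) (μ : Measure X) : ENNReal :=
  ⨆ (k : ℕ) (ξ : X → Fin k) (_ : Measurable ξ), entropyOfPartition T μ ξ

/-! ### The Parry measure -/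

/-- `lam` is the largest eigenvalue of `A`, with strictly positive left and right eigenvectors `u`
and `v`, normalized by `∑ i, u i * v i = 1`. -/
structure IsPerronData {s : ℕ} (A : Matrix (Fin s) (Fin s) ℝ) (lam : ℝ) (u v : Fin s → ℝ) :
    Prop where
  isGreatest : IsGreatest {t : ℝ | Module.End.HasEigenvalue (Matrix.toLin' A) t} lam
  left_pos : ∀ i, 0 < u i
  right_pos : ∀ i, 0 < v i
  left_eigen : Matrix.vecMul u A = lam • u
  right_eigen : Matrix.mulVec A v = lam • v
  normalized : ∑ i, u i * v i = 1

/-- The initial distribution `p i = u i * v i`. -/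
def parryInit {s : ℕ} (u v : Fin s → ℝ) (i : Fin s) : ℝ := u i * v i

/-- The transition probabilities `p i j = A i j * v j / (lam * v i)`. -/
def parryTrans {s : ℕ} (A : Matrix (Fin s) (Fin s) ℝ) (lam : ℝ) (v : Fin s → ℝ) (i j : Fin s) :
    ℝ :=
  A i j * v j / (lam * v i)

/-- The Markov weight `p (w 0) * p (w 0) (w 1) * ⋯ * p (w (k - 1)) (w k)` of the word
`w 0, …, w k`. -/
def parryWeight {s : ℕ} (A : Matrix (Fin s) (Fin s) ℝ) (lam : ℝ) (u v : Fin s → ℝ)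
    (w : ℕ → Fin s) (k : ℕ) : ℝ :=
  parryInit u v (w 0) * ∏ n ∈ Finset.range k, parryTrans A lam v (w n) (w (n + 1))

/-- `m` is the stationary Markov measure on the one-sided subshift with initial distribution
`parryInit` and transition probabilities `parryTrans`. -/
def IsOneSidedParry {s : ℕ} (A : Matrix (Fin s) (Fin s) ℝ) (m : Measure (OneSidedShift A)) :
    Prop :=
  ∃ (lam : ℝ) (u v : Fin s → ℝ), IsPerronData A lam u v ∧ ∀ (w : ℕ → Fin s) (k : ℕ),
    m {x | ∀ n ≤ k, x.1 n = w n} = ENNReal.ofReal (parryWeight A lam u v w k)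

/-- `m` is the stationary Markov measure on the two-sided subshift with one-dimensional
distribution `parryInit` and transition probabilities `parryTrans`. -/
def IsTwoSidedParry {s : ℕ} (A : Matrix (Fin s) (Fin s) ℝ) (m : Measure (TwoSidedShift A)) :
    Prop :=
  ∃ (lam : ℝ) (u v : Fin s → ℝ), IsPerronData A lam u v ∧
    ∀ (l : ℤ) (w : ℕ → Fin s) (k : ℕ),
      m {x | ∀ n : ℕ, n ≤ k → x.1 (l + n) = w n} = ENNReal.ofReal (parryWeight A lam u v w k)

open Classical in
/-- The Parry measure on the one-sided subshift: the measure with the prescribed Markov weights on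
cylinders. For irreducible `A` it exists and is unique; the value `0` is only a default for
matrices for which there is none. -/
def oneSidedParry {s : ℕ} (A : Matrix (Fin s) (Fin s) ℝ) : Measure (OneSidedShift A) :=
  if h : ∃ m, IsOneSidedParry A m then h.choose else 0

open Classical in
/-- The Parry measure on the two-sided subshift, with the same convention. -/
def twoSidedParry {s : ℕ} (A : Matrix (Fin s) (Fin s) ℝ) : Measure (TwoSidedShift A) :=
  if h : ∃ m, IsTwoSidedParry A m then h.choose else 0

end

noncomputable section

/-! ### Entropy of finite partitions -/

section FiniteEntropy

variable {X ι κ τ : Type*} [MeasurableSpace X]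
  [Fintype ι] [MeasurableSpace ι] [MeasurableSingletonClass ι]
  [Fintype κ] [MeasurableSpace κ] [MeasurableSingletonClass κ]
  [Fintype τ] [MeasurableSpace τ] [MeasurableSingletonClass τ]

/-! Started from any letter law π, the Parry chain gives an admissible word w₀…w_k the weight π(w₀)
v(w_k) / (λ^k v(w₀)): apart from the end letters it depends on the length only
(`chainWeight_of_admissible`). Take for π the letter law of an invariant μ, and let H_n be the
μ-entropy of words of length n. In the relative entropy of the μ-law of words with respect to this
chain the end terms cancel by invariance, leaving k log λ − (H_{k+1} − H_1)
(`relEntropy_chainWeight`). Concavity of n ↦ H_n and approximation of partitions by blocks give h_μ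
≤ (H_{k+1} − H_1)/k (`measureEntropy_le`), while log λ ≤ h_m. So the relative entropy is at most k
(h_m − h_μ), and a Pinsker inequality turns this into an ℓ¹ bound.

It remains to replace π by the stationary letter law p. The case k = 1 says that π is stationary up
to O((h_m − h_μ)^{1/2}); stationary vectors of an irreducible chain are unique up to scaling, so
linear algebra in finite dimension bounds ∑ |π_i − p_i| by the same order
(`exists_sum_abs_le_sum_abs_defect`). Hence the block laws of length l under μ and m differ in ℓ¹ by
O(l (h_m − h_μ)^{1/2}) (`exists_sum_abs_block_sub_le`).

A Lipschitz f is a constant plus a telescoping series whose n-th term depends on the central block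
of order n + 1 and has size at most |f|_θ θ^{-n}. Blocks have length at most 2(n + 1), so the errors
are dominated by the convergent series ∑ (n + 1) θ^{-n} (`exists_abs_integral_sub_le`).

Both shifts are instances of `IsSymbolicCoding`. Since the Parry measure is defined by choice,
Perron–Frobenius data and the measure itself have to be constructed as well. -/

theorem integral_comp_eq_sum (μ : Measure X) [IsFiniteMeasure μ] {ξ : X → ι} (hξ : Measurable ξ)
    (φ : ι → ℝ) : ∫ x, φ (ξ x) ∂μ = ∑ i, μ.real (ξ ⁻¹' {i}) * φ i := by
  have h1 : ∫ x, φ (ξ x) ∂μ = ∫ i, φ i ∂(μ.map ξ) := by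
    rw [integral_map hξ.aemeasurable]
    exact (measurable_of_countable φ).aestronglyMeasurable
  rw [h1, integral_fintype (.of_finite)]
  refine Finset.sum_congr rfl fun i _ => ?_
  rw [map_measureReal_apply hξ (measurableSet_singleton i), smul_eq_mul]

theorem measureReal_preimage_eq_sum (μ : Measure X) [IsFiniteMeasure μ] {ξ : X → ι}
    (hξ : Measurable ξ) (p : ι → Prop) [DecidablePred p] :
    μ.real {x | p (ξ x)} = ∑ i with p i, μ.real (ξ ⁻¹' {i}) := by
  have : {x | p (ξ x)} = ξ ⁻¹' ((Finset.univ.filter p : Finset ι) : Set ι) := by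
    ext x; simp
  rw [this, ← sum_measureReal_preimage_singleton]
  intro i _
  exact hξ (measurableSet_singleton i)

theorem sum_measureReal_fiber (μ : Measure X) [IsProbabilityMeasure μ] {ξ : X → ι}
    (hξ : Measurable ξ) : ∑ i, μ.real (ξ ⁻¹' {i}) = 1 := by
  have := measureReal_preimage_eq_sum μ hξ (fun _ => True)
  simpa using this.symm

theorem measureReal_fst_fiber {α : Type*} (μ : Measure X) [IsFiniteMeasure μ] {ξ : X → α}
    {ζ : X → κ} (hζ : Measurable ζ) (i : α) :
    μ.real (ξ ⁻¹' {i}) = ∑ j, μ.real ((fun x => (ξ x, ζ x)) ⁻¹' {(i, j)}) := by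
  classical
  have := measureReal_preimage_eq_sum (μ.restrict (ξ ⁻¹' {i})) hζ (fun _ => True)
  simp only [Set.ofPred_true, Finset.filter_true] at this
  rw [measureReal_restrict_apply MeasurableSet.univ, Set.univ_inter] at this
  rw [this]
  refine Finset.sum_congr rfl fun j _ => ?_
  rw [measureReal_restrict_apply (hζ (measurableSet_singleton j))]
  congr 1
  ext x
  simp [and_comm]

/-- Each p i is at most the total and log is monotone. This is why merging cells lowers entropy. -/
theorem negMulLog_sum_le {α : Type*} (t : Finset α) (p : α → ℝ) (hp : ∀ i ∈ t, 0 ≤ p i) :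
    Real.negMulLog (∑ i ∈ t, p i) ≤ ∑ i ∈ t, Real.negMulLog (p i) := by
  unfold Real.negMulLog
  rw [neg_mul, Finset.sum_mul, ← Finset.sum_neg_distrib]
  refine Finset.sum_le_sum fun i hi => ?_
  rcases (hp i hi).eq_or_lt with h | h
  · simp [← h]
  · have h2 : p i ≤ ∑ i ∈ t, p i := Finset.single_le_sum hp hi
    have := Real.log_le_log h h2
    nlinarith

theorem partitionEntropy_comp_le {α : Type*} [Fintype α] (μ : Measure X) [IsFiniteMeasure μ]
    {ξ : X → ι} (hξ : Measurable ξ) (g : ι → α) :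
    partitionEntropy μ (fun x => g (ξ x)) ≤ partitionEntropy μ ξ := by
  classical
  unfold partitionEntropy
  have h : ∀ k, μ.real ((fun x => g (ξ x)) ⁻¹' {k}) = ∑ i with g i = k, μ.real (ξ ⁻¹' {i}) :=
    fun k => measureReal_preimage_eq_sum μ hξ (fun i => g i = k)
  calc _ ≤ ∑ k, ∑ i with g i = k, Real.negMulLog (μ.real (ξ ⁻¹' {i})) := by
        refine Finset.sum_le_sum fun k _ => ?_
        rw [h]
        exact negMulLog_sum_le _ _ fun i _ => measureReal_nonneg
    _ = _ := Finset.sum_fiberwise _ _ _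

/-- A labelling that is a function of another one has the smaller entropy. -/
theorem partitionEntropy_le_of_factor {α : Type*} [Fintype α] (μ : Measure X)
    [IsFiniteMeasure μ] {ξ : X → ι} {ζ : X → α} (hξ : Measurable ξ)
    (h : ∀ x y, ξ x = ξ y → ζ x = ζ y) :
    partitionEntropy μ ζ ≤ partitionEntropy μ ξ := by
  classical
  rcases isEmpty_or_nonempty X with hX | hX
  · simp [partitionEntropy, Set.eq_empty_of_isEmpty]
  obtain ⟨g, hg⟩ : ∃ g : ι → α, ζ = fun x => g (ξ x) := by
    refine ⟨fun i => if hi : ∃ x, ξ x = i then ζ hi.choose else ζ hX.some, funext fun x => ?_⟩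
    have hi : ∃ y, ξ y = ξ x := ⟨x, rfl⟩
    simp only [hi, dif_pos]
    exact (h _ _ hi.choose_spec).symm
  rw [hg]
  exact partitionEntropy_comp_le μ hξ g

theorem partitionEntropy_congr_factor (μ : Measure X) [IsFiniteMeasure μ] {ξ : X → ι} {ζ : X → κ}
    (hξ : Measurable ξ) (hζ : Measurable ζ) (h : ∀ x y, ξ x = ξ y ↔ ζ x = ζ y) :
    partitionEntropy μ ζ = partitionEntropy μ ξ :=
  le_antisymm (partitionEntropy_le_of_factor μ hξ fun x y => (h x y).1)
    (partitionEntropy_le_of_factor μ hζ fun x y => (h x y).2)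

theorem partitionEntropy_comp_measurePreserving {Y : Type*} [MeasurableSpace Y] {μ : Measure X}
    {ν : Measure Y} {T : X → Y} (hT : MeasurePreserving T μ ν) {ξ : Y → ι} (hξ : Measurable ξ) :
    partitionEntropy μ (fun x => ξ (T x)) = partitionEntropy ν ξ := by
  unfold partitionEntropy
  refine Finset.sum_congr rfl fun i _ => ?_
  congr 1
  exact hT.measureReal_preimage (hξ (measurableSet_singleton i)).nullMeasurableSet

/-- This is log z ≤ z − 1 at z = rt/(py), multiplied by p. The bounds by p make r, t, y positive as
soon as p is, so no logarithm of zero interferes. -/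
theorem mul_log_submodular_term {p r t y : ℝ} (hp : 0 ≤ p) (hr : p ≤ r) (ht : p ≤ t)
    (hy : p ≤ y) :
    -(p * Real.log p) - p * Real.log y + p * Real.log r + p * Real.log t ≤ r * t / y - p := by
  rcases hp.eq_or_lt with h | h
  · subst h
    simp only [zero_mul]
    have : 0 ≤ r * t / y := by positivity
    linarith
  · have hr' : 0 < r := h.trans_le hr
    have ht' : 0 < t := h.trans_le ht
    have hy' : 0 < y := h.trans_le hy
    have h1 := Real.log_le_sub_one_of_pos (show 0 < r * t / (p * y) by positivity)
    rw [Real.log_div (by positivity) (by positivity), Real.log_mul hr'.ne' ht'.ne',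
      Real.log_mul h.ne' hy'.ne'] at h1
    have h2 := mul_le_mul_of_nonneg_left h1 h.le
    have h3 : p * (r * t / (p * y) - 1) = r * t / y - p := by field_simp
    linarith

/-- For fixed b the pointwise inequality is summed over a and c: with r and t the two marginals and
y the total mass, the right sides rt/y − p add up to y·y/y − y = 0. -/
theorem sum_negMulLog_submodular {α β γ : Type*} [Fintype α] [Fintype β] [Fintype γ]
    (p : α → β → γ → ℝ) (hp : ∀ a b c, 0 ≤ p a b c) :
    ∑ a, ∑ b, ∑ c, Real.negMulLog (p a b c) + ∑ b, Real.negMulLog (∑ a, ∑ c, p a b c) ≤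
      ∑ a, ∑ b, Real.negMulLog (∑ c, p a b c) + ∑ b, ∑ c, Real.negMulLog (∑ a, p a b c) := by
  have key : ∀ b, ∑ a, ∑ c, Real.negMulLog (p a b c) + Real.negMulLog (∑ a, ∑ c, p a b c) ≤
      ∑ a, Real.negMulLog (∑ c, p a b c) + ∑ c, Real.negMulLog (∑ a, p a b c) := by
    intro b
    set y := ∑ a, ∑ c, p a b c with hy
    have hr : ∀ a c, p a b c ≤ ∑ c, p a b c := fun a c =>
      Finset.single_le_sum (f := fun c => p a b c) (fun c _ => hp a b c) (Finset.mem_univ c)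
    have ht : ∀ a c, p a b c ≤ ∑ a, p a b c := fun a c =>
      Finset.single_le_sum (f := fun a => p a b c) (fun a _ => hp a b c) (Finset.mem_univ a)
    have hry : ∀ a, ∑ c, p a b c ≤ y := fun a =>
      Finset.single_le_sum (f := fun a => ∑ c, p a b c)
        (fun a _ => Finset.sum_nonneg fun c _ => hp a b c) (Finset.mem_univ a)
    have h1 := Finset.sum_le_sum fun a (_ : a ∈ Finset.univ) =>
      Finset.sum_le_sum fun c (_ : c ∈ Finset.univ) =>
        mul_log_submodular_term (hp a b c) (hr a c) (ht a c) ((hr a c).trans (hry a))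
    have e1 : ∑ a, ∑ c, ((∑ c, p a b c) * (∑ a, p a b c) / y - p a b c) = y * y / y - y := by
      simp only [Finset.sum_sub_distrib, ← Finset.sum_div, ← Finset.mul_sum, ← Finset.sum_mul]
      rw [Finset.sum_comm (γ := γ), ← hy]
    -- With the convention x / 0 = 0 this also covers y = 0.
    have e2 : y * y / y - y = 0 := by
      rw [mul_self_div_self, sub_self]
    rw [e1, e2] at h1
    simp only [Finset.sum_add_distrib, Finset.sum_sub_distrib] at h1
    have e3 : ∑ a, ∑ c, p a b c * Real.log y = y * Real.log y := by
      simp only [← Finset.sum_mul, ← hy]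
    have e4 : ∑ a, ∑ c, p a b c * Real.log (∑ c, p a b c) =
        ∑ a, (∑ c, p a b c) * Real.log (∑ c, p a b c) := by
      simp only [← Finset.sum_mul]
    have e5 : ∑ a, ∑ c, p a b c * Real.log (∑ a, p a b c) =
        ∑ c, (∑ a, p a b c) * Real.log (∑ a, p a b c) := by
      rw [Finset.sum_comm]
      simp only [← Finset.sum_mul]
    rw [e3, e4, e5] at h1
    simp only [Real.negMulLog, neg_mul, Finset.sum_neg_distrib] at h1 ⊢
    linarith
  have := Finset.sum_le_sum fun b (_ : b ∈ Finset.univ) => key b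
  simp only [Finset.sum_add_distrib] at this
  have s1 := Finset.sum_comm (s := Finset.univ) (t := Finset.univ)
    (f := fun a b => ∑ c, Real.negMulLog (p a b c))
  have s2 := Finset.sum_comm (s := Finset.univ) (t := Finset.univ)
    (f := fun a b => Real.negMulLog (∑ c, p a b c))
  rw [s1, s2]
  exact this

/-- Strong subadditivity of the entropy of partitions. -/
theorem partitionEntropy_submodular {α : Type*} [Fintype α] (μ : Measure X) [IsFiniteMeasure μ]
    {ξ : X → ι} {ζ : X → α} {χ : X → τ} (hξ : Measurable ξ) (hχ : Measurable χ) :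
    partitionEntropy μ (fun x => (ξ x, ζ x, χ x)) + partitionEntropy μ ζ ≤
      partitionEntropy μ (fun x => (ξ x, ζ x)) + partitionEntropy μ (fun x => (ζ x, χ x)) := by
  have h := sum_negMulLog_submodular
    (fun a b c => μ.real ((fun x => (ξ x, ζ x, χ x)) ⁻¹' {(a, b, c)}))
    (fun _ _ _ => measureReal_nonneg)
  have e1 : ∀ a b, μ.real ((fun x => (ξ x, ζ x)) ⁻¹' {(a, b)}) =
      ∑ c, μ.real ((fun x => (ξ x, ζ x, χ x)) ⁻¹' {(a, b, c)}) := by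
    intro a b
    rw [measureReal_fst_fiber μ hχ (a, b)]
    refine Finset.sum_congr rfl fun c _ => ?_
    congr 1
    ext x
    simp [and_assoc]
  have e2 : ∀ b c, μ.real ((fun x => (ζ x, χ x)) ⁻¹' {(b, c)}) =
      ∑ a, μ.real ((fun x => (ξ x, ζ x, χ x)) ⁻¹' {(a, b, c)}) := by
    intro b c
    rw [measureReal_fst_fiber μ hξ (b, c)]
    refine Finset.sum_congr rfl fun a _ => ?_
    congr 1
    ext x
    simp [and_comm]
  have e3 : ∀ b, μ.real (ζ ⁻¹' {b}) =
      ∑ a, ∑ c, μ.real ((fun x => (ξ x, ζ x, χ x)) ⁻¹' {(a, b, c)}) := by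
    intro b
    rw [measureReal_fst_fiber μ hξ b]
    refine Finset.sum_congr rfl fun a _ => ?_
    rw [← e1]
    congr 1
    ext x
    simp [and_comm]
  simp only [partitionEntropy, Fintype.sum_prod_type, e1, e2, e3]
  exact h

/-- The conditional entropy `H(ξ | ζ)` tends to `0` as `μ {ξ ≠ ζ}` tends to `0`. -/
theorem exists_partitionEntropy_prod_le (μ : Measure X) [IsFiniteMeasure μ] {ξ : X → ι}
    (hξ : Measurable ξ) {ε : ℝ} (hε : 0 < ε) :
    ∃ δ > 0, ∀ ζ : X → ι, Measurable ζ → μ.real {x | ξ x ≠ ζ x} < δ →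
      partitionEntropy μ (fun x => (ξ x, ζ x)) ≤ partitionEntropy μ ζ + ε := by
  classical
  -- A sequence of counterexamples ζ n with error below 1/(n+1) has cell masses converging to those
  -- of ξ. Both entropies are finite sums of a continuous function, so in the limit H(ξ) + ε ≤ H(ξ,
  -- ξ) = H(ξ).
  by_contra! hcon
  choose ζ hζ hlt hgt using fun n : ℕ => hcon (1 / ((n : ℝ) + 1)) (by positivity)
  have hlim : Tendsto (fun n => μ.real {x | ξ x ≠ ζ n x}) atTop (nhds 0) :=
    squeeze_zero (fun _ => measureReal_nonneg) (fun n => (hlt n).le)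
      tendsto_one_div_add_atTop_nhds_zero_nat
  have hclose : ∀ (s : ℕ → Set X) (t : Set X), (∀ n, s n ⊆ t ∪ {x | ξ x ≠ ζ n x}) →
      (∀ n, t ⊆ s n ∪ {x | ξ x ≠ ζ n x}) →
      Tendsto (fun n => μ.real (s n)) atTop (nhds (μ.real t)) := by
    intro s t h1 h2
    rw [tendsto_iff_norm_sub_tendsto_zero]
    refine squeeze_zero (fun _ => norm_nonneg _) (fun n => ?_) hlim
    have a1 := (measureReal_mono (μ := μ) (h1 n)).trans (measureReal_union_le _ _)
    have a2 := (measureReal_mono (μ := μ) (h2 n)).trans (measureReal_union_le _ _)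
    rw [Real.norm_eq_abs, abs_le]
    constructor <;> linarith
  have l1 : Tendsto (fun n => partitionEntropy μ (ζ n)) atTop (nhds (partitionEntropy μ ξ)) := by
    refine tendsto_finsetSum _ fun i _ => ?_
    refine (Real.continuous_negMulLog.tendsto _).comp (hclose _ _ ?_ ?_) <;> intro n x hx
    · by_cases h : ξ x = ζ n x <;> simp_all
    · by_cases h : ξ x = ζ n x <;> simp_all
  have l2 : Tendsto (fun n => partitionEntropy μ (fun x => (ξ x, ζ n x))) atTop
      (nhds (partitionEntropy μ (fun x => (ξ x, ξ x)))) := by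
    refine tendsto_finsetSum _ fun i _ => ?_
    refine (Real.continuous_negMulLog.tendsto _).comp (hclose _ _ ?_ ?_) <;> intro n x hx
    · by_cases h : ξ x = ζ n x
      · exact Or.inl (by simpa [h] using hx)
      · exact Or.inr h
    · by_cases h : ξ x = ζ n x
      · exact Or.inl (by simpa [h] using hx)
      · exact Or.inr h
  have e : partitionEntropy μ (fun x => (ξ x, ξ x)) = partitionEntropy μ ξ :=
    partitionEntropy_congr_factor μ hξ (hξ.prodMk hξ) (by simp)
  rw [e] at l2
  have := le_of_tendsto_of_tendsto (l1.add_const ε) l2 (Eventually.of_forall fun n => (hgt n).le)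
  linarith

/-- A form of Pinsker's inequality for finite distributions. -/
theorem sum_abs_sub_le_two_mul_sqrt_relEntropy {α : Type*} [Fintype α] (p q : α → ℝ)
    (hp : ∀ i, 0 ≤ p i) (hq : ∀ i, 0 ≤ q i) (hac : ∀ i, q i = 0 → p i = 0)
    (hp1 : ∑ i, p i = 1) (hq1 : ∑ i, q i = 1) :
    ∑ i, |p i - q i| ≤ 2 * √(∑ i, p i * (Real.log (p i) - Real.log (q i))) := by
  -- log z ≤ z − 1 at z = √(q/p): relative entropy dominates the squared Hellinger distance.
  -- Cauchy–Schwarz on |p − q| = |√p − √q|(√p + √q) then gives the constant 2, from ∑ (√p + √q)² ≤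
  -- 4.
  have hterm : ∀ i, (√(p i) - √(q i)) ^ 2 ≤
      p i * (Real.log (p i) - Real.log (q i)) - p i + q i := by
    intro i
    rcases (hp i).eq_or_lt with h | h
    · simp [← h, Real.sq_sqrt (hq i)]
    · have hqi : 0 < q i := (hq i).lt_of_ne fun h0 => h.ne' (hac i h0.symm)
      have hsp := Real.sqrt_pos.2 h
      have hsq := Real.sqrt_pos.2 hqi
      have h1 := Real.log_le_sub_one_of_pos (div_pos hsq hsp)
      rw [Real.log_div hsq.ne' hsp.ne', Real.log_sqrt (hq i), Real.log_sqrt (hp i)] at h1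
      have h2 := mul_le_mul_of_nonneg_left h1 h.le
      have h3 : p i * (√(q i) / √(p i) - 1) = √(p i) * √(q i) - p i := by
        have h4 := Real.mul_self_sqrt (hp i)
        rw [mul_sub, mul_one, ← mul_div_assoc, mul_comm, mul_div_assoc, div_eq_of_eq_mul hsp.ne'
          h4.symm, mul_comm]
      have h4 := Real.sq_sqrt (hp i)
      have h5 := Real.sq_sqrt (hq i)
      nlinarith
  have hD : ∑ i, (√(p i) - √(q i)) ^ 2 ≤ ∑ i, p i * (Real.log (p i) - Real.log (q i)) := by
    have := Finset.sum_le_sum fun i (_ : i ∈ Finset.univ) => hterm i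
    rw [Finset.sum_add_distrib, Finset.sum_sub_distrib] at this
    linarith
  have hS : ∑ i, (√(p i) + √(q i)) ^ 2 ≤ 4 := by
    have : ∀ i, (√(p i) + √(q i)) ^ 2 ≤ 2 * p i + 2 * q i := by
      intro i
      have h4 := Real.sq_sqrt (hp i)
      have h5 := Real.sq_sqrt (hq i)
      nlinarith [sq_nonneg (√(p i) - √(q i))]
    have := Finset.sum_le_sum fun i (_ : i ∈ Finset.univ) => this i
    rw [Finset.sum_add_distrib, ← Finset.mul_sum, ← Finset.mul_sum] at this
    linarith
  have hfac : ∀ i, |p i - q i| = |√(p i) - √(q i)| * (√(p i) + √(q i)) := by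
    intro i
    have h0 : 0 ≤ √(p i) + √(q i) := by positivity
    conv_rhs => rw [← abs_of_nonneg h0]
    rw [← abs_mul]
    congr 1
    have h4 := Real.sq_sqrt (hp i)
    have h5 := Real.sq_sqrt (hq i)
    linarith [show (√(p i) - √(q i)) * (√(p i) + √(q i)) = √(p i) ^ 2 - √(q i) ^ 2 by ring]
  have hCS := Real.sum_mul_le_sqrt_mul_sqrt Finset.univ (fun i => |√(p i) - √(q i)|)
    (fun i => √(p i) + √(q i))
  simp only [sq_abs] at hCS
  calc ∑ i, |p i - q i| = ∑ i, |√(p i) - √(q i)| * (√(p i) + √(q i)) := by simp only [hfac]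
    _ ≤ _ := hCS
    _ ≤ √(∑ i, p i * (Real.log (p i) - Real.log (q i))) * 2 := by
      refine mul_le_mul (Real.sqrt_le_sqrt hD) ?_ (Real.sqrt_nonneg _) (Real.sqrt_nonneg _)
      rw [Real.sqrt_le_left (by norm_num)]
      linarith
    _ = _ := mul_comm _ _

end FiniteEntropy

/-! ### Entropy of joins -/

section Joins

variable {X ι κ : Type*} [MeasurableSpace X]
  [Fintype ι] [MeasurableSpace ι] [MeasurableSingletonClass ι]
  [Fintype κ] [MeasurableSpace κ] [MeasurableSingletonClass κ]

theorem measurable_partitionJoin {α : Type*} [MeasurableSpace α] {T : X → X} (hT : Measurable T)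
    {ξ : X → α} (hξ : Measurable ξ) (n : ℕ) : Measurable (partitionJoin T ξ n) :=
  measurable_pi_lambda _ fun i => hξ.comp (hT.iterate i)

theorem partitionJoin_eq_iff {α : Type*} {Y : Type*} {T : Y → Y} {ξ : Y → α} {n : ℕ} {x y : Y} :
    partitionJoin T ξ n x = partitionJoin T ξ n y ↔
      ∀ i < n, ξ (T^[i] x) = ξ (T^[i] y) := by
  simp [partitionJoin, funext_iff, Fin.forall_iff]

theorem partitionJoin_succ_eq_iff {α : Type*} {Y : Type*} {T : Y → Y} {ξ : Y → α} {n : ℕ}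
    {x y : Y} : partitionJoin T ξ (n + 1) x = partitionJoin T ξ (n + 1) y ↔
      ξ (T^[n] x) = ξ (T^[n] y) ∧ partitionJoin T ξ n x = partitionJoin T ξ n y := by
  simp only [partitionJoin_eq_iff, Nat.lt_succ_iff_lt_or_eq]
  constructor
  · intro h
    exact ⟨h n (Or.inr rfl), fun i hi => h i (Or.inl hi)⟩
  · rintro ⟨h1, h2⟩ i (hi | rfl)
    · exact h2 i hi
    · exact h1

theorem partitionJoin_succ_eq_iff' {α : Type*} {Y : Type*} {T : Y → Y} {ξ : Y → α} {n : ℕ}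
    {x y : Y} : partitionJoin T ξ (n + 1) x = partitionJoin T ξ (n + 1) y ↔
      ξ x = ξ y ∧ partitionJoin T ξ n (T x) = partitionJoin T ξ n (T y) := by
  simp only [partitionJoin_eq_iff]
  constructor
  · intro h
    exact ⟨h 0 (Nat.succ_pos n), fun i hi => h (i + 1) (Nat.succ_lt_succ hi)⟩
  · rintro ⟨h1, h2⟩ i hi
    cases i with
    | zero => exact h1
    | succ i => exact h2 i (Nat.lt_of_succ_lt_succ hi)

/-- Strong subadditivity with the first letter, the n middle letters and the last letter; by
invariance both words of n + 1 letters have the same entropy. -/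
theorem partitionEntropy_partitionJoin_concave {μ : Measure X} [IsFiniteMeasure μ] {T : X → X}
    (hT : MeasurePreserving T μ μ) {ξ : X → ι} (hξ : Measurable ξ) (n : ℕ) :
    partitionEntropy μ (partitionJoin T ξ (n + 2)) + partitionEntropy μ (partitionJoin T ξ n) ≤
      2 * partitionEntropy μ (partitionJoin T ξ (n + 1)) := by
  have hJ := fun k => measurable_partitionJoin hT.measurable hξ k
  have hζ : Measurable (fun x => partitionJoin T ξ n (T x)) := (hJ n).comp hT.measurable
  have hχ : Measurable (fun x => ξ (T^[n + 1] x)) := hξ.comp (hT.measurable.iterate _)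
  have h := partitionEntropy_submodular (ζ := fun x => partitionJoin T ξ n (T x)) μ hξ hχ
  rw [partitionEntropy_comp_measurePreserving hT (hJ n)] at h
  have e1 : partitionEntropy μ (fun x => (ξ x, partitionJoin T ξ n (T x), ξ (T^[n + 1] x))) =
      partitionEntropy μ (partitionJoin T ξ (n + 2)) := by
    refine partitionEntropy_congr_factor μ (hJ _) (hξ.prodMk (hζ.prodMk hχ)) fun x y => ?_
    rw [partitionJoin_succ_eq_iff', partitionJoin_succ_eq_iff]
    simp [and_comm]
  have e2 : partitionEntropy μ (fun x => (ξ x, partitionJoin T ξ n (T x))) =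
      partitionEntropy μ (partitionJoin T ξ (n + 1)) := by
    refine partitionEntropy_congr_factor μ (hJ _) (hξ.prodMk hζ) fun x y => ?_
    rw [partitionJoin_succ_eq_iff']
    simp
  have e3 : partitionEntropy μ (fun x => (partitionJoin T ξ n (T x), ξ (T^[n + 1] x))) =
      partitionEntropy μ (partitionJoin T ξ (n + 1)) := by
    rw [← partitionEntropy_comp_measurePreserving hT (hJ (n + 1))]
    refine partitionEntropy_congr_factor μ ((hJ _).comp hT.measurable) (hζ.prodMk hχ)
      fun x y => ?_
    rw [partitionJoin_succ_eq_iff]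
    simp [and_comm]
  rw [e1, e2, e3] at h
  linarith

/-- The increments decrease, so every increment after k + 1 is at most the k-th one, which is at
most the average of increments 1 to k. It bounds the growth rate of H by a finite-stage quotient. -/
theorem le_of_concave_sequence {H : ℕ → ℝ} (hH : ∀ n, H (n + 2) + H n ≤ 2 * H (n + 1))
    (k j : ℕ) : k * (H (k + 1 + j) - H (k + 1)) ≤ j * (H (k + 1) - H 1) := by
  have hanti : Antitone fun n => H (n + 1) - H n :=
    antitone_nat_of_succ_le fun n => by
      have := hH n
      change H (n + 2) - H (n + 1) ≤ _
      linarith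
  have h1 : ∀ m, m ≤ k → (m : ℝ) * (H (k + 1) - H k) ≤ H (m + 1) - H 1 := by
    intro m
    induction m with
    | zero => simp
    | succ m ih =>
      intro hm
      have := ih (by omega)
      have h2 : H (k + 1) - H k ≤ H (m + 1 + 1) - H (m + 1) := hanti hm
      push_cast
      linarith
  have h2 : ∀ j : ℕ, H (k + 1 + j) - H (k + 1) ≤ j * (H (k + 1) - H k) := by
    intro j
    induction j with
    | zero => simp
    | succ j ih =>
      have h2 : H (k + 1 + j + 1) - H (k + 1 + j) ≤ H (k + 1) - H k :=
        hanti (show k ≤ k + 1 + j by omega)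
      push_cast
      rw [← add_assoc]
      linarith
  calc (k : ℝ) * (H (k + 1 + j) - H (k + 1)) ≤ k * (j * (H (k + 1) - H k)) :=
        mul_le_mul_of_nonneg_left (h2 j) (Nat.cast_nonneg k)
    _ = j * (k * (H (k + 1) - H k)) := by ring
    _ ≤ _ := mul_le_mul_of_nonneg_left (h1 k le_rfl) (Nat.cast_nonneg j)

/-- `H(ξ ∨ ⋯ ∨ T^{-(n-1)} ξ) ≤ H(ζ ∨ ⋯ ∨ T^{-(n-1)} ζ) + n H(ξ | ζ)`. -/
theorem partitionEntropy_partitionJoin_le_add {μ : Measure X} [IsFiniteMeasure μ] {T : X → X}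
    (hT : MeasurePreserving T μ μ) {ξ : X → ι} {ζ : X → κ} (hξ : Measurable ξ)
    (hζ : Measurable ζ) {δ : ℝ}
    (hδ : partitionEntropy μ (fun x => (ξ x, ζ x)) ≤ partitionEntropy μ ζ + δ) (n : ℕ) :
    partitionEntropy μ (partitionJoin T ξ n) ≤
      partitionEntropy μ (partitionJoin T ζ n) + n * δ := by
  have hJξ := fun k => measurable_partitionJoin hT.measurable hξ k
  have hJζ := fun k => measurable_partitionJoin hT.measurable hζ k
  have hξi := fun k => hξ.comp (hT.measurable.iterate k)
  have hζi := fun k => hζ.comp (hT.measurable.iterate k)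
  -- The joint entropy of both joins is what can be bounded inductively: one more step adds a
  -- ζ-letter, absorbed into the longer ζ-join, and a ξ-letter, which costs at most H(ξ | ζ) ≤ δ by
  -- stationarity.
  have key : partitionEntropy μ (fun x => (partitionJoin T ζ n x, partitionJoin T ξ n x)) ≤
      partitionEntropy μ (partitionJoin T ζ n) + n * δ := by
    induction n with
    | zero =>
      refine (partitionEntropy_le_of_factor μ (hJζ 0) fun x y _ => ?_).trans (by simp)
      exact Prod.ext (Subsingleton.elim _ _) (Subsingleton.elim _ _)
    | succ n ih =>
      have h1 := partitionEntropy_submodular (ζ := ζ ∘ T^[n]) μ (hξi n) ((hJζ n).prodMk (hJξ n))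
      have h2 := partitionEntropy_submodular (ζ := partitionJoin T ζ n) μ (hζi n) (hJξ n)
      have e1 : partitionEntropy μ (ζ ∘ T^[n]) = partitionEntropy μ ζ :=
        partitionEntropy_comp_measurePreserving (hT.iterate n) hζ
      have e2 : partitionEntropy μ (fun x => ((ξ ∘ T^[n]) x, (ζ ∘ T^[n]) x)) =
          partitionEntropy μ (fun x => (ξ x, ζ x)) :=
        partitionEntropy_comp_measurePreserving (hT.iterate n) (hξ.prodMk hζ)
      have e3 : partitionEntropy μ (fun x => ((ζ ∘ T^[n]) x, partitionJoin T ζ n x)) =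
          partitionEntropy μ (partitionJoin T ζ (n + 1)) := by
        refine partitionEntropy_congr_factor μ (hJζ _) ((hζi n).prodMk (hJζ n)) fun x y => ?_
        rw [partitionJoin_succ_eq_iff]
        simp
      have e4 : partitionEntropy μ
          (fun x => (partitionJoin T ζ (n + 1) x, partitionJoin T ξ (n + 1) x)) =
          partitionEntropy μ (fun x =>
            ((ξ ∘ T^[n]) x, (ζ ∘ T^[n]) x, partitionJoin T ζ n x, partitionJoin T ξ n x)) := by
        refine partitionEntropy_congr_factor μ
          ((hξi n).prodMk ((hζi n).prodMk ((hJζ n).prodMk (hJξ n))))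
          ((hJζ _).prodMk (hJξ _)) fun x y => ?_
        simp only [Prod.mk.injEq, partitionJoin_succ_eq_iff, Function.comp_apply]
        tauto
      rw [e1, e2] at h1
      rw [e3] at h2
      rw [e4]
      push_cast
      linarith
  exact (partitionEntropy_le_of_factor μ ((hJζ n).prodMk (hJξ n)) fun x y h =>
    (Prod.ext_iff.1 h).2).trans key

end Joins

/-! ### Symbolic codings -/

/-- A dynamical system coded by admissible sequences: `b n` reads the first letter of the central
block of order `n`, which consists of `L n` consecutive letters, and two points agree to order `n`
if these blocks coincide. -/
structure IsSymbolicCoding {s : ℕ} (A : Matrix (Fin s) (Fin s) ℝ) {X : Type*} [MeasurableSpace X]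
    (T : X → X) (agree : ℕ → X → X → Prop) (b : ℕ → X → Fin s) (L : ℕ → ℕ) : Prop where
  measurable_map : Measurable T
  measurable_letter : ∀ n, Measurable (b n)
  exists_shift : ∀ n, ∃ j, ∀ x, b n (T^[j] x) = b 0 x
  agree_iff : ∀ n x y, agree n x y ↔
    partitionJoin T (b n) (L n) x = partitionJoin T (b n) (L n) y
  length_zero : L 0 = 0
  length_le : ∀ n, L n ≤ 2 * n
  agree_of_succ : ∀ n x y, agree (n + 1) x y → agree n x y
  eq_of_agree : ∀ x y, (∀ n, agree n x y) → x = y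
  le_generate : ‹MeasurableSpace X› ≤
    ⨆ n, MeasurableSpace.comap (partitionJoin T (b n) (L n)) inferInstance
  admissible : ∀ x, A (b 0 x) (b 0 (T x)) = 1

namespace IsSymbolicCoding

variable {s : ℕ} {A : Matrix (Fin s) (Fin s) ℝ} {X : Type*} [mX : MeasurableSpace X]
  {T : X → X} {agree : ℕ → X → X → Prop} {b : ℕ → X → Fin s} {L : ℕ → ℕ}

theorem agree_mono (hC : IsSymbolicCoding A T agree b L) {m n : ℕ} (hmn : m ≤ n) {x y : X}
    (h : agree n x y) : agree m x y := by
  induction n, hmn using Nat.le_induction with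
  | base => exact h
  | succ n _ ih => exact ih (hC.agree_of_succ n x y h)

theorem measurable_block (hC : IsSymbolicCoding A T agree b L) (n k : ℕ) :
    Measurable (partitionJoin T (b n) k) :=
  measurable_partitionJoin hC.measurable_map (hC.measurable_letter n) k

theorem agree_symm (hC : IsSymbolicCoding A T agree b L) {n : ℕ} {x y : X} (h : agree n x y) :
    agree n y x :=
  (hC.agree_iff n y x).2 ((hC.agree_iff n x y).1 h).symm

theorem agree_trans (hC : IsSymbolicCoding A T agree b L) {n : ℕ} {x y z : X} (h : agree n x y)
    (h' : agree n y z) : agree n x z :=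
  (hC.agree_iff n x z).2 (((hC.agree_iff n x y).1 h).trans ((hC.agree_iff n y z).1 h'))

theorem exists_eq_comp_block (hC : IsSymbolicCoding A T agree b L) {α : Type*} [Nonempty α] {n : ℕ}
    {g : X → α} (hg : ∀ x y, agree n x y → g x = g y) :
    ∃ φ : (Fin (L n) → Fin s) → α, ∀ x, g x = φ (partitionJoin T (b n) (L n) x) := by
  obtain ⟨φ, hφ⟩ := (Function.factorsThrough_iff (f := partitionJoin T (b n) (L n)) g).1
    fun x y h => hg x y ((hC.agree_iff n x y).2 h)
  exact ⟨φ, fun x => congrFun hφ x⟩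

theorem measurable_of_agree (hC : IsSymbolicCoding A T agree b L) {α : Type*} [MeasurableSpace α]
    [Nonempty α] {n : ℕ} {g : X → α} (hg : ∀ x y, agree n x y → g x = g y) : Measurable g := by
  obtain ⟨φ, hφ⟩ := hC.exists_eq_comp_block hg
  rw [funext hφ]
  exact (measurable_of_countable φ).comp (hC.measurable_block n (L n))

/-- The sets determined by some central block: two of them are both determined at the larger of
their orders. They serve as a dense algebra for approximating partitions and as a π-system for
identifying measures. -/
theorem isSetAlgebra_saturated (hC : IsSymbolicCoding A T agree b L) :
    IsSetAlgebra {t : Set X | ∃ n, ∀ x y, agree n x y → (x ∈ t ↔ y ∈ t)} where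
  empty_mem := ⟨0, by simp⟩
  compl_mem := by
    rintro t ⟨n, hn⟩
    exact ⟨n, fun x y h => not_congr (hn x y h)⟩
  union_mem := by
    rintro t t' ⟨n, hn⟩ ⟨n', hn'⟩
    exact ⟨max n n', fun x y h => or_congr (hn x y (hC.agree_mono (le_max_left _ _) h))
      (hn' x y (hC.agree_mono (le_max_right _ _) h))⟩

theorem measurableSet_of_agree (hC : IsSymbolicCoding A T agree b L) {n : ℕ} {t : Set X}
    (ht : ∀ x y, agree n x y → (x ∈ t ↔ y ∈ t)) : MeasurableSet t :=
  measurableSet_setOfPred.2 (hC.measurable_of_agree (g := fun x => x ∈ t)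
    fun x y h => propext (ht x y h))

theorem generateFrom_saturated (hC : IsSymbolicCoding A T agree b L) :
    mX = MeasurableSpace.generateFrom
      {t : Set X | ∃ n, ∀ x y, agree n x y → (x ∈ t ↔ y ∈ t)} := by
  refine le_antisymm (hC.le_generate.trans (iSup_le fun n => ?_)) ?_
  · rintro _ ⟨S, _, rfl⟩
    refine MeasurableSpace.measurableSet_generateFrom ⟨n, fun x y h => ?_⟩
    rw [Set.mem_preimage, Set.mem_preimage, (hC.agree_iff n x y).1 h]
  · refine MeasurableSpace.generateFrom_le ?_
    rintro t ⟨n, ht⟩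
    exact hC.measurableSet_of_agree ht

/-- Every finite measurable partition is approximated by partitions into unions of blocks. -/
theorem exists_approx (hC : IsSymbolicCoding A T agree b L) (μ : Measure X) [IsFiniteMeasure μ]
    {k : ℕ} {ξ : X → Fin k} (hξ : Measurable ξ) {δ : ℝ} (hδ : 0 < δ) :
    ∃ (n : ℕ) (ζ : X → Fin k), Measurable ζ ∧ (∀ x y, agree n x y → ζ x = ζ y) ∧
      μ.real {x | ξ x ≠ ζ x} < δ := by
  classical
  rcases isEmpty_or_nonempty X with hX | ⟨⟨x₀⟩⟩
  · exact ⟨0, ξ, hξ, fun x => hX.elim x, by simpa using hδ⟩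
  have hk : 0 < k := (ξ x₀).pos
  have hd := Measure.MeasureDense.of_generateFrom_isSetAlgebra_finite (μ := μ)
    hC.isSetAlgebra_saturated hC.generateFrom_saturated
  have hδk : 0 < δ / k := div_pos hδ (by exact_mod_cast hk)
  choose t ht htμ using fun i => hd.approx (ξ ⁻¹' {i}) (hξ (measurableSet_singleton i))
    (measure_ne_top _ _) (δ / k) hδk
  choose n hn using ht
  let N := Finset.univ.sup n
  have hN : ∀ i x y, agree N x y → (x ∈ t i ↔ y ∈ t i) := fun i x y h =>
    hn i x y (hC.agree_mono (Finset.le_sup (Finset.mem_univ i)) h)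
  -- A point gets the label of any approximating set containing it. Off the symmetric differences it
  -- lies in exactly one of them, with the right label, so the default `ξ x₀` and the choice matter
  -- only on the exceptional set, whose mass is below k · δ/k.
  let F : (Fin k → Prop) → Fin k := fun p => if h : ∃ i, p i then h.choose else ξ x₀
  let ζ : X → Fin k := fun x => F fun i => x ∈ t i
  have hζ : ∀ x y, agree N x y → ζ x = ζ y := fun x y h =>
    congrArg F (funext fun i => propext (hN i x y h))
  have : Nonempty (Fin k) := ⟨ξ x₀⟩
  refine ⟨N, ζ, hC.measurable_of_agree hζ, hζ, ?_⟩
  have hsub : {x | ξ x ≠ ζ x} ⊆ ⋃ i ∈ Finset.univ, symmDiff (ξ ⁻¹' {i}) (t i) := by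
    intro x hx
    by_contra hcon
    have hiff : ∀ i, x ∈ t i ↔ ξ x = i := by
      intro i
      have : x ∉ symmDiff (ξ ⁻¹' {i}) (t i) := fun h =>
        hcon (Set.mem_biUnion (Finset.mem_coe.2 (Finset.mem_univ i)) h)
      rw [Set.mem_symmDiff] at this
      simp only [Set.mem_preimage, Set.mem_singleton_iff] at this
      tauto
    have hex : ∃ i, x ∈ t i := ⟨ξ x, (hiff _).2 rfl⟩
    apply hx
    simp only [ζ, F, hex, dif_pos]
    exact (hiff _).1 hex.choose_spec
  calc μ.real {x | ξ x ≠ ζ x} ≤ μ.real (⋃ i ∈ Finset.univ, symmDiff (ξ ⁻¹' {i}) (t i)) :=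
        measureReal_mono hsub (measure_ne_top _ _)
    _ ≤ ∑ i, μ.real (symmDiff (ξ ⁻¹' {i}) (t i)) := measureReal_biUnion_finset_le _ _
    _ < ∑ _i : Fin k, δ / k := by
        refine Finset.sum_lt_sum_of_nonempty ⟨ξ x₀, Finset.mem_univ _⟩ fun i _ => ?_
        exact (ENNReal.lt_ofReal_iff_toReal_lt (measure_ne_top _ _)).1 (htμ i)
    _ = δ := by
        have : (k : ℝ) ≠ 0 := by exact_mod_cast hk.ne'
        simp; field_simp

/-- The letter `b n` read j steps later is `b 0`, so invariance makes words read from any starting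
position equidistributed. -/
theorem partitionEntropy_block (hC : IsSymbolicCoding A T agree b L) {μ : Measure X}
    (hT : MeasurePreserving T μ μ) (n k : ℕ) :
    partitionEntropy μ (partitionJoin T (b n) k) =
      partitionEntropy μ (partitionJoin T (b 0) k) := by
  obtain ⟨j, hj⟩ := hC.exists_shift n
  rw [← partitionEntropy_comp_measurePreserving (hT.iterate j) (hC.measurable_block n k)]
  congr 1
  funext x i
  simp only [partitionJoin]
  rw [← Function.iterate_add_apply, add_comm, Function.iterate_add_apply, hj]

/-- The Kolmogorov–Sinai theorem for codings: the partition according to the letters bounds the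
entropy. -/
theorem measureEntropy_le (hC : IsSymbolicCoding A T agree b L) {μ : Measure X}
    [IsProbabilityMeasure μ] (hT : MeasurePreserving T μ μ) {k : ℕ} (hk : 0 < k) :
    measureEntropy T μ ≤ ENNReal.ofReal ((partitionEntropy μ (partitionJoin T (b 0) (k + 1)) -
      partitionEntropy μ (partitionJoin T (b 0) 1)) / k) := by
  set H : ℕ → ℝ := fun n => partitionEntropy μ (partitionJoin T (b 0) n) with hH
  set c := (H (k + 1) - H 1) / k with hc
  change _ ≤ ENNReal.ofReal c
  have hk' : (0 : ℝ) < k := by exact_mod_cast hk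
  have hc0 : 0 ≤ c := by
    refine div_nonneg (sub_nonneg.2 ?_) hk'.le
    refine partitionEntropy_le_of_factor μ (hC.measurable_block 0 _) fun x y h => ?_
    rw [partitionJoin_eq_iff] at h ⊢
    exact fun i hi => h i (by omega)
  have hgrow : ∀ j, H (k + 1 + j) ≤ H (k + 1) + j * c := by
    intro j
    have := le_of_concave_sequence (H := H)
      (partitionEntropy_partitionJoin_concave hT (hC.measurable_letter 0)) k j
    change k * (H (k + 1 + j) - H (k + 1)) ≤ j * (H (k + 1) - H 1) at this
    have h2 : k * (H (k + 1 + j) - H (k + 1)) ≤ k * (j * c) := by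
      rw [hc]
      calc _ ≤ _ := this
        _ = _ := by field_simp
    have := le_of_mul_le_mul_left h2 hk'
    linarith
  refine iSup_le fun l => iSup_le fun ξ => iSup_le fun hξ => ?_
  refine ENNReal.le_of_forall_pos_le_add fun ε hε _ => ?_
  obtain ⟨δ, hδ, hδ'⟩ := exists_partitionEntropy_prod_le μ hξ (show (0 : ℝ) < ε from hε)
  obtain ⟨N, ζ, hζ, hζN, hζδ⟩ := hC.exists_approx μ hξ hδ
  have h1 := partitionEntropy_partitionJoin_le_add hT hξ hζ (hδ' ζ hζ hζδ)
  -- One label of ζ depends on `L N` consecutive letters, so n successive labels depend on fewer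
  -- than n + `L N` letters. The fixed overlap disappears after division by n.
  have h2 : ∀ n, partitionEntropy μ (partitionJoin T ζ n) ≤ H (n + L N) := by
    intro n
    rw [hH]
    simp only
    rw [← hC.partitionEntropy_block hT N]
    refine partitionEntropy_le_of_factor μ (hC.measurable_block N _) fun x y h => ?_
    rw [partitionJoin_eq_iff] at h ⊢
    intro i hi
    apply hζN
    rw [hC.agree_iff, partitionJoin_eq_iff]
    intro j hj
    rw [← Function.iterate_add_apply, ← Function.iterate_add_apply]
    exact h _ (by omega)
  have h3 : ∀ n ≥ k + 1, partitionEntropy μ (partitionJoin T ξ n) / n ≤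
      c + ε + (H (k + 1) + L N * c) / n := by
    intro n hn
    have hn0 : (0 : ℝ) < n := by exact_mod_cast (by omega : 0 < n)
    obtain ⟨j, hj⟩ := Nat.exists_eq_add_of_le (show k + 1 ≤ n + L N by omega)
    have h4 := hgrow j
    rw [← hj] at h4
    have h5 : (j : ℝ) ≤ n + L N := by exact_mod_cast (by omega : j ≤ n + L N)
    have h6 := mul_le_mul_of_nonneg_right h5 hc0
    have h7 := h1 n
    have h8 := h2 n
    rw [div_le_iff₀ hn0, add_mul, div_mul_cancel₀ _ hn0.ne']
    linarith
  have hlim : Tendsto (fun n : ℕ => ENNReal.ofReal (c + ε + (H (k + 1) + L N * c) / n)) atTop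
      (nhds (ENNReal.ofReal (c + ε))) := by
    refine ENNReal.tendsto_ofReal ?_
    simpa using (tendsto_const_div_atTop_nhds_zero_nat (H (k + 1) + L N * c)).const_add
      (c + (ε : ℝ))
  calc entropyOfPartition T μ ξ ≤ _ := limsup_le_limsup
        ((eventually_ge_atTop (k + 1)).mono fun n hn => ENNReal.ofReal_le_ofReal (h3 n hn))
    _ = ENNReal.ofReal (c + ε) := hlim.limsup_eq
    _ = ENNReal.ofReal c + ε := by
      rw [ENNReal.ofReal_add hc0 ε.coe_nonneg, ENNReal.ofReal_coe_nnreal]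

end IsSymbolicCoding

/-! ### The Parry chain -/

section ParryChain

variable {s : ℕ} {A : Matrix (Fin s) (Fin s) ℝ} {lam : ℝ} {u v : Fin s → ℝ}

theorem parryInit_pos (hP : IsPerronData A lam u v) (i : Fin s) : 0 < parryInit u v i :=
  mul_pos (hP.left_pos i) (hP.right_pos i)

theorem parryTrans_nonneg (hP : IsPerronData A lam u v) (hA : ∀ i j, 0 ≤ A i j) (hlam : 0 < lam)
    (i j : Fin s) : 0 ≤ parryTrans A lam v i j :=
  div_nonneg (mul_nonneg (hA i j) (hP.right_pos j).le) (mul_pos hlam (hP.right_pos i)).le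

theorem sum_parryTrans (hP : IsPerronData A lam u v) (hlam : 0 < lam) (i : Fin s) :
    ∑ j, parryTrans A lam v i j = 1 := by
  have h := congrFun hP.right_eigen i
  simp only [Matrix.mulVec, dotProduct, Pi.smul_apply, smul_eq_mul] at h
  simp only [parryTrans]
  rw [← Finset.sum_div, h, div_self (mul_pos hlam (hP.right_pos i)).ne']

theorem sum_parryInit_mul_parryTrans (hP : IsPerronData A lam u v) (hlam : 0 < lam) (j : Fin s) :
    ∑ i, parryInit u v i * parryTrans A lam v i j = parryInit u v j := by
  have h := congrFun hP.left_eigen j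
  simp only [Matrix.vecMul, dotProduct, Pi.smul_apply, smul_eq_mul] at h
  have e : ∀ i, parryInit u v i * parryTrans A lam v i j = u i * A i j * (v j / lam) := by
    intro i
    have := (hP.right_pos i).ne'
    simp only [parryInit, parryTrans]
    field_simp
  simp only [e]
  rw [← Finset.sum_mul, h, parryInit]
  field_simp

/-- Summing over a letter `a` prepended to w uses stationarity of the initial law; this is what
makes the cylinder weights shift invariant. -/
theorem sum_parryWeight_cons (hP : IsPerronData A lam u v) (hlam : 0 < lam) (w : ℕ → Fin s)
    (k : ℕ) : ∑ a, parryWeight A lam u v (fun n => Nat.casesOn n a w) (k + 1) =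
      parryWeight A lam u v w k := by
  simp only [parryWeight, Finset.prod_range_succ']
  rw [← sum_parryInit_mul_parryTrans hP hlam (w 0), Finset.sum_mul]
  refine Finset.sum_congr rfl fun a _ => ?_
  change parryInit u v a * ((∏ n ∈ Finset.range k, parryTrans A lam v (w n) (w (n + 1))) *
    parryTrans A lam v a (w 0)) = _
  ring

/-- The weight of the word `w` under the Markov chain with initial weights `π` and the transition
probabilities of the Parry measure. -/
def chainWeight (A : Matrix (Fin s) (Fin s) ℝ) (lam : ℝ) (v : Fin s → ℝ) (π : Fin s → ℝ) {k : ℕ}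
    (w : Fin (k + 1) → Fin s) : ℝ :=
  π (w 0) * ∏ i : Fin k, parryTrans A lam v (w i.castSucc) (w i.succ)

/-- Sum out the last letter, since the transition rows add up to one. The initial weights are
arbitrary, so that the lemma also applies to |π − π'|. -/
theorem sum_chainWeight (hP : IsPerronData A lam u v) (hlam : 0 < lam) (π : Fin s → ℝ) (k : ℕ) :
    ∑ w : Fin (k + 1) → Fin s, chainWeight A lam v π w = ∑ i, π i := by
  induction k with
  | zero =>
    rw [← (Equiv.funUnique (Fin 1) (Fin s)).symm.sum_comp]
    simp [chainWeight]
  | succ k ih =>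
    rw [← ih, ← (Fin.snocEquiv fun _ => Fin s).sum_comp, Fintype.sum_prod_type_right]
    refine Finset.sum_congr rfl fun w _ => ?_
    have : ∀ j, chainWeight A lam v π ((Fin.snocEquiv fun _ => Fin s) (j, w)) =
        chainWeight A lam v π w * parryTrans A lam v (w (Fin.last k)) j := by
      intro j
      simp only [chainWeight, Fin.snocEquiv, Equiv.coe_fn_mk, Fin.prod_univ_castSucc,
        Fin.snoc_castSucc, Fin.succ_last, Fin.snoc_last, ← Fin.castSucc_succ]
      rw [← Fin.castSucc_zero, Fin.snoc_castSucc, mul_assoc]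
    simp only [this]
    rw [← Finset.mul_sum, sum_parryTrans hP hlam, mul_one]

theorem chainWeight_nonneg (hP : IsPerronData A lam u v) (hA : ∀ i j, 0 ≤ A i j) (hlam : 0 < lam)
    {π : Fin s → ℝ} (hπ : ∀ i, 0 ≤ π i) {k : ℕ} (w : Fin (k + 1) → Fin s) :
    0 ≤ chainWeight A lam v π w :=
  mul_nonneg (hπ _) (Finset.prod_nonneg fun _ _ => parryTrans_nonneg hP hA hlam _ _)

/-- Both chains share the nonnegative transition factors, so the ℓ¹ distance of the word laws is
exactly that of the initial weights. -/
theorem sum_abs_chainWeight_sub (hP : IsPerronData A lam u v) (hA : ∀ i j, 0 ≤ A i j)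
    (hlam : 0 < lam) (π π' : Fin s → ℝ) (k : ℕ) :
    ∑ w : Fin (k + 1) → Fin s, |chainWeight A lam v π w - chainWeight A lam v π' w| =
      ∑ i, |π i - π' i| := by
  rw [← sum_chainWeight hP hlam (fun i => |π i - π' i|) k]
  refine Finset.sum_congr rfl fun w _ => ?_
  rw [chainWeight, chainWeight, ← sub_mul, abs_mul, chainWeight]
  congr 1
  exact abs_of_nonneg (Finset.prod_nonneg fun _ _ => parryTrans_nonneg hP hA hlam _ _)

/-- The factors v_j / (λ v_i) telescope along the word. This near-uniformity is what singles out the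
Parry chain and makes its relative entropies computable. -/
theorem chainWeight_of_admissible (hP : IsPerronData A lam u v) (hlam : 0 < lam) (π : Fin s → ℝ)
    {k : ℕ} (w : Fin (k + 1) → Fin s) (hw : ∀ i : Fin k, A (w i.castSucc) (w i.succ) = 1) :
    chainWeight A lam v π w = π (w 0) * (v (w (Fin.last k)) / (lam ^ k * v (w 0))) := by
  rw [chainWeight]
  congr 1
  induction k with
  | zero => simp [div_self (hP.right_pos _).ne']
  | succ k ih =>
    have := ih (fun i => w i.castSucc) fun i => by simpa using hw i.castSucc
    rw [Fin.prod_univ_castSucc]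
    simp only [Fin.succ_castSucc] at this ⊢
    rw [this]
    have h1 := hw (Fin.last k)
    rw [Fin.succ_last] at h1 ⊢
    rw [parryTrans, h1, Fin.castSucc_zero]
    have h2 := (hP.right_pos (w (Fin.last k).castSucc)).ne'
    field_simp
    ring

theorem perron_eigenvalue_pos (hs : 2 ≤ s) (hirr : A.IsIrreducible)
    (hP : IsPerronData A lam u v) : 0 < lam := by
  have : Nontrivial (Fin s) := Fin.nontrivial_iff_two_le.2 hs
  let i : Fin s := ⟨0, by omega⟩
  obtain ⟨j, hj⟩ := hirr.exists_pos i
  have h := congrFun hP.right_eigen i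
  simp only [Matrix.mulVec, dotProduct, Pi.smul_apply, smul_eq_mul] at h
  have h1 : 0 < ∑ j, A i j * v j :=
    Finset.sum_pos' (fun j _ => mul_nonneg (hirr.nonneg i j) (hP.right_pos j).le)
      ⟨j, Finset.mem_univ j, mul_pos hj (hP.right_pos j)⟩
  rw [h] at h1
  exact pos_of_mul_pos_left h1 (hP.right_pos i).le

theorem vecMul_pow_of_eigen {z : Fin s → ℝ} (hz : Matrix.vecMul z A = lam • z) (n : ℕ) :
    Matrix.vecMul z (A ^ n) = lam ^ n • z := by
  induction n with
  | zero => simp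
  | succ n ih => rw [pow_succ, ← Matrix.vecMul_vecMul, ih, Matrix.smul_vecMul, hz, smul_smul,
      pow_succ]

/-- The left eigenspace of an irreducible matrix at the Perron eigenvalue is one-dimensional. -/
theorem left_eigenvector_eq_smul [NeZero s] (hirr : A.IsIrreducible) (hP : IsPerronData A lam u v)
    {y : Fin s → ℝ} (hy : Matrix.vecMul y A = lam • y) : ∃ c : ℝ, y = c • u := by
  -- The minimal ratio y/u gives the largest c with y − cu ≥ 0. This difference is a nonnegative
  -- left eigenvector vanishing at i, and positivity of some (A^n) k i for each k forces it to
  -- vanish everywhere.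
  obtain ⟨i, -, hi⟩ := Finset.exists_min_image Finset.univ (fun i => y i / u i)
    Finset.univ_nonempty
  refine ⟨y i / u i, ?_⟩
  set c := y i / u i with hc
  have hz0 : ∀ k, 0 ≤ (y - c • u) k := by
    intro k
    have := (le_div_iff₀ (hP.left_pos k)).1 (hi k (Finset.mem_univ k))
    simpa using this
  have hzi : (y - c • u) i = 0 := by
    simp [hc, div_mul_cancel₀ _ (hP.left_pos i).ne']
  have hz : Matrix.vecMul (y - c • u) A = lam • (y - c • u) := by
    rw [Matrix.sub_vecMul, hy, Matrix.smul_vecMul, hP.left_eigen, smul_sub, smul_comm]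
  rw [← sub_eq_zero]
  funext k
  obtain ⟨n, -, hn⟩ := (Matrix.isIrreducible_iff_exists_pow_pos hirr.nonneg).1 hirr k i
  have h := congrFun (vecMul_pow_of_eigen hz n) i
  rw [Pi.smul_apply, hzi, smul_zero] at h
  simp only [Matrix.vecMul, dotProduct] at h
  have hnn : ∀ k, 0 ≤ (y - c • u) k * (A ^ n) k i := fun k =>
    mul_nonneg (hz0 k) (Matrix.pow_apply_nonneg hirr.nonneg n k i)
  have := (Finset.sum_eq_zero_iff_of_nonneg fun k _ => hnn k).1 h k (Finset.mem_univ k)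
  exact (mul_eq_zero.1 this).resolve_right hn.ne'

/-- A zero-sum vector is controlled by its defect of stationarity. -/
theorem exists_sum_abs_le_sum_abs_defect [NeZero s] (hirr : A.IsIrreducible)
    (hP : IsPerronData A lam u v) (hlam : 0 < lam) :
    ∃ C : ℝ, 0 ≤ C ∧ ∀ x : Fin s → ℝ, ∑ i, x i = 0 →
      ∑ i, |x i| ≤ C * ∑ j, |x j - ∑ i, x i * parryTrans A lam v i j| := by
  let P : Matrix (Fin s) (Fin s) ℝ := Matrix.of fun i j => parryTrans A lam v i j
  -- An injective linear map in finite dimension is bounded below. For the kernel: dividing a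
  -- stationary row vector entrywise by v gives a left eigenvector of A, hence a multiple of u, and
  -- zero sum makes the multiple zero.
  let φ : (Fin s → ℝ) →ₗ[ℝ] (Fin s → ℝ) × ℝ :=
    (LinearMap.id - Matrix.vecMulLinear P).prod (∑ i, LinearMap.proj i)
  have hφ : ∀ x, φ x = (x - Matrix.vecMul x P, ∑ i, x i) := by
    intro x
    simp [φ]
  have hker : LinearMap.ker φ = ⊥ := by
    rw [LinearMap.ker_eq_bot']
    intro x hx
    rw [hφ, Prod.mk_eq_zero, sub_eq_zero] at hx
    obtain ⟨hx1, hx2⟩ := hx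
    have hy : Matrix.vecMul (fun i => x i / v i) A = lam • fun i => x i / v i := by
      funext j
      have h := congrFun hx1 j
      have hv := (hP.right_pos j).ne'
      simp only [Matrix.vecMul, dotProduct, P, Matrix.of_apply, parryTrans, Pi.smul_apply,
        smul_eq_mul] at h ⊢
      have e : ∀ i, x i * (A i j * v j / (lam * v i)) = x i / v i * A i j * (v j / lam) := by
        intro i
        have := (hP.right_pos i).ne'
        field_simp
      simp only [e] at h
      rw [← Finset.sum_mul] at h
      rw [h]
      field_simp
    obtain ⟨c, hc⟩ := left_eigenvector_eq_smul hirr hP hy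
    have hxc : ∀ i, x i = c * (u i * v i) := by
      intro i
      have h := congrFun hc i
      simp only [Pi.smul_apply, smul_eq_mul] at h
      rw [← mul_assoc, ← h, div_mul_cancel₀ _ (hP.right_pos i).ne']
    simp only [hxc] at hx2
    rw [← Finset.mul_sum, hP.normalized, mul_one] at hx2
    funext i
    simp [hxc i, hx2]
  obtain ⟨K, -, hK⟩ := LinearMap.exists_antilipschitzWith φ hker
  -- The factor s compares the ℓ¹ norm with the sup norm used by the antilipschitz bound.
  refine ⟨s * K, by positivity, fun x hx => ?_⟩
  have h1 : ‖x‖ ≤ K * ‖φ x‖ := by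
    have := hK.le_mul_dist x 0
    simpa using this
  have h2 : ‖φ x‖ ≤ ∑ j, |x j - ∑ i, x i * parryTrans A lam v i j| := by
    rw [hφ, hx]
    have hnn : 0 ≤ ∑ j, |x j - ∑ i, x i * parryTrans A lam v i j| :=
      Finset.sum_nonneg fun j _ => abs_nonneg _
    refine norm_prod_le_iff.2 ⟨(pi_norm_le_iff_of_nonneg hnn).2 fun j => ?_, by simpa using hnn⟩
    exact Finset.single_le_sum (f := fun j => |x j - ∑ i, x i * parryTrans A lam v i j|)
      (fun j _ => abs_nonneg _) (Finset.mem_univ j)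
  calc ∑ i, |x i| ≤ ∑ _i : Fin s, ‖x‖ := Finset.sum_le_sum fun i _ => norm_le_pi_norm x i
    _ = s * ‖x‖ := by simp
    _ ≤ s * (K * ∑ j, |x j - ∑ i, x i * parryTrans A lam v i j|) := by
      gcongr
      exact h1.trans (by gcongr)
    _ = _ := by ring

end ParryChain

theorem measure_eq_sum_inter_fiber {X : Type*} [MeasurableSpace X] {s : ℕ} (ν : Measure X)
    {g : X → Fin s}
    (hg : Measurable g) (E : Set X) : ν E = ∑ a, ν (g ⁻¹' {a} ∩ E) := by
  have h := sum_measure_preimage_singleton (μ := ν.restrict E) Finset.univ (f := g)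
    fun a _ => hg (measurableSet_singleton a)
  rw [Finset.coe_univ, Set.preimage_univ, Measure.restrict_apply_univ] at h
  rw [← h]
  exact Finset.sum_congr rfl fun a _ => Measure.restrict_apply (hg (measurableSet_singleton a))

/-! ### Relative entropy, the Parry law and the laws of blocks -/

namespace IsSymbolicCoding

variable {s : ℕ} {A : Matrix (Fin s) (Fin s) ℝ} {lam : ℝ} {u v : Fin s → ℝ}
  {X : Type*} [mX : MeasurableSpace X]
  {T : X → X} {agree : ℕ → X → X → Prop} {b : ℕ → X → Fin s} {L : ℕ → ℕ}

theorem measureReal_block (hC : IsSymbolicCoding A T agree b L) {μ : Measure X}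
    (hT : MeasurePreserving T μ μ) (n k : ℕ) (w : Fin k → Fin s) :
    μ.real (partitionJoin T (b n) k ⁻¹' {w}) = μ.real (partitionJoin T (b 0) k ⁻¹' {w}) := by
  obtain ⟨j, hj⟩ := hC.exists_shift n
  rw [← (hT.iterate j).measureReal_preimage
    (hC.measurable_block n k (measurableSet_singleton w)).nullMeasurableSet]
  congr 1
  ext x
  simp only [Set.mem_preimage, Set.mem_singleton_iff]
  congr! 1
  funext i
  simp only [partitionJoin]
  rw [← Function.iterate_add_apply, add_comm, Function.iterate_add_apply, hj]

/-- The relative entropy of the law of the words of length `k + 1` with respect to the Parry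
chain started from the letter distribution. -/
theorem relEntropy_chainWeight (hC : IsSymbolicCoding A T agree b L)
    (hP : IsPerronData A lam u v) (hlam : 0 < lam) {μ : Measure X} [IsProbabilityMeasure μ]
    (hT : MeasurePreserving T μ μ) (k : ℕ) :
    ∑ w : Fin (k + 1) → Fin s, μ.real (partitionJoin T (b 0) (k + 1) ⁻¹' {w}) *
      (Real.log (μ.real (partitionJoin T (b 0) (k + 1) ⁻¹' {w})) -
        Real.log (chainWeight A lam v (fun i => μ.real (b 0 ⁻¹' {i})) w)) =
      k * Real.log lam - (partitionEntropy μ (partitionJoin T (b 0) (k + 1)) -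
        partitionEntropy μ (partitionJoin T (b 0) 1)) ∧
    ∀ w : Fin (k + 1) → Fin s, chainWeight A lam v (fun i => μ.real (b 0 ⁻¹' {i})) w = 0 →
      μ.real (partitionJoin T (b 0) (k + 1) ⁻¹' {w}) = 0 := by
  set W := partitionJoin T (b 0) (k + 1) with hW
  have hWm : Measurable W := hC.measurable_block 0 (k + 1)
  have hb := hC.measurable_letter 0
  set π : Fin s → ℝ := fun i => μ.real (b 0 ⁻¹' {i}) with hπ
  -- A word of nonzero mass is realised by a point, hence admissible, so the telescoped formula
  -- applies; words of mass zero contribute nothing.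
  have hword : ∀ w, μ.real (W ⁻¹' {w}) ≠ 0 → 0 < π (w 0) ∧
      chainWeight A lam v π w = π (w 0) * (v (w (Fin.last k)) / (lam ^ k * v (w 0))) := by
    intro w hw
    have hpos : 0 < μ.real (W ⁻¹' {w}) := measureReal_nonneg.lt_of_ne hw.symm
    constructor
    · refine hpos.trans_le (measureReal_mono ?_ (measure_ne_top _ _))
      rintro x rfl
      simp [W, partitionJoin]
    · obtain ⟨x, hx⟩ : (W ⁻¹' {w}).Nonempty := by
        by_contra hne
        rw [Set.not_nonempty_iff_eq_empty] at hne
        simp [hne] at hw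
      rw [Set.mem_preimage, Set.mem_singleton_iff] at hx
      refine chainWeight_of_admissible hP hlam π w fun i => ?_
      rw [← hx]
      simp only [W, partitionJoin, Fin.val_castSucc, Fin.val_succ, Function.iterate_succ_apply']
      exact hC.admissible _
  constructor
  · have hterm : ∀ w, μ.real (W ⁻¹' {w}) * (Real.log (μ.real (W ⁻¹' {w})) -
        Real.log (chainWeight A lam v π w)) = -Real.negMulLog (μ.real (W ⁻¹' {w})) -
        μ.real (W ⁻¹' {w}) * Real.log (π (w 0)) + μ.real (W ⁻¹' {w}) * (k * Real.log lam) -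
        μ.real (W ⁻¹' {w}) * Real.log (v (w (Fin.last k))) +
        μ.real (W ⁻¹' {w}) * Real.log (v (w 0)) := by
      intro w
      by_cases hw : μ.real (W ⁻¹' {w}) = 0
      · simp [hw]
      · obtain ⟨h1, h2⟩ := hword w hw
        have hv := hP.right_pos
        rw [h2, Real.log_mul h1.ne' (div_pos (hv _) (mul_pos (pow_pos hlam k) (hv _))).ne',
          Real.log_div (hv _).ne' (mul_pos (pow_pos hlam k) (hv _)).ne',
          Real.log_mul (pow_pos hlam k).ne' (hv _).ne', Real.log_pow, Real.negMulLog]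
        ring
    simp only [hterm, Finset.sum_add_distrib, Finset.sum_sub_distrib, ← Finset.sum_mul]
    rw [sum_measureReal_fiber μ hWm, one_mul]
    -- By invariance every position of the word has letter law π; therefore the log v terms at the
    -- two ends cancel.
    have hint : ∀ (φ : Fin s → ℝ) (i : Fin (k + 1)),
        ∑ w, μ.real (W ⁻¹' {w}) * φ (w i) = ∑ a, π a * φ a := by
      intro φ i
      rw [← integral_comp_eq_sum μ hWm (fun w => φ (w i)), ← integral_comp_eq_sum μ hb φ]
      have hmp := hT.iterate i
      conv_rhs => rw [← hmp.map_eq]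
      rw [integral_map hmp.measurable.aemeasurable]
      · rfl
      · exact ((measurable_of_countable φ).comp hb).aestronglyMeasurable
    rw [hint (fun a => Real.log (π a)) 0, hint (fun a => Real.log (v a)) 0,
      hint (fun a => Real.log (v a)) (Fin.last k)]
    have h1 : partitionEntropy μ (partitionJoin T (b 0) 1) = -∑ a, π a * Real.log (π a) := by
      rw [partitionEntropy_congr_factor μ hb (hC.measurable_block 0 1)]
      · simp [partitionEntropy, Real.negMulLog, hπ]
      · intro x y
        simp [partitionJoin_eq_iff]
    rw [h1]
    simp only [Finset.sum_neg_distrib, partitionEntropy]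
    ring
  · intro w hw
    by_contra hne
    obtain ⟨h1, h2⟩ := hword w hne
    have hv := hP.right_pos
    rw [h2] at hw
    exact (mul_pos h1 (div_pos (hv _) (mul_pos (pow_pos hlam k) (hv _)))).ne' hw

/-- The defining property of the Parry measure for a symbolic coding. -/
def HasParryLaw (A : Matrix (Fin s) (Fin s) ℝ) (lam : ℝ) (u v : Fin s → ℝ) (T : X → X)
    (b : ℕ → X → Fin s) (m : Measure X) : Prop :=
  ∀ (n : ℕ) (w : ℕ → Fin s) (k : ℕ),
    m {x | ∀ i ≤ k, b n (T^[i] x) = w i} = ENNReal.ofReal (parryWeight A lam u v w k)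

theorem parryWeight_nonneg (hP : IsPerronData A lam u v) (hA : ∀ i j, 0 ≤ A i j) (hlam : 0 < lam)
    (w : ℕ → Fin s) (k : ℕ) : 0 ≤ parryWeight A lam u v w k :=
  mul_nonneg (parryInit_pos hP _).le
    (Finset.prod_nonneg fun _ _ => parryTrans_nonneg hP hA hlam _ _)

theorem HasParryLaw.isProbabilityMeasure (hC : IsSymbolicCoding A T agree b L)
    (hP : IsPerronData A lam u v) {m : Measure X} (hm : HasParryLaw A lam u v T b m) :
    IsProbabilityMeasure m := by
  have h : ∀ a, m (b 0 ⁻¹' {a}) = ENNReal.ofReal (parryInit u v a) := by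
    intro a
    have := hm 0 (fun _ => a) 0
    simp only [parryWeight, Finset.range_zero, Finset.prod_empty, mul_one] at this
    rw [← this]
    congr 1
    ext x
    simp
  constructor
  have hU : (Set.univ : Set X) = b 0 ⁻¹' ((Finset.univ : Finset (Fin s)) : Set (Fin s)) := by simp
  rw [hU, ← sum_measure_preimage_singleton _
    fun a _ => hC.measurable_letter 0 (measurableSet_singleton a)]
  simp only [h]
  rw [← ENNReal.ofReal_sum_of_nonneg fun a _ => (parryInit_pos hP a).le]
  simp [parryInit, hP.normalized]

theorem HasParryLaw.measureReal_block {m : Measure X} (hP : IsPerronData A lam u v)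
    (hA : ∀ i j, 0 ≤ A i j) (hlam : 0 < lam) (hm : HasParryLaw A lam u v T b m) (n : ℕ) {k : ℕ}
    (w : Fin (k + 1) → Fin s) :
    m.real (partitionJoin T (b n) (k + 1) ⁻¹' {w}) = chainWeight A lam v (parryInit u v) w := by
  let w' : ℕ → Fin s := fun i => w (Fin.ofNat (k + 1) i)
  have hw' : ∀ i : Fin (k + 1), w' i = w i := by
    intro i
    simp [w']
  have h := hm n w' k
  have e : {x | ∀ i ≤ k, b n (T^[i] x) = w' i} = partitionJoin T (b n) (k + 1) ⁻¹' {w} := by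
    ext x
    simp only [Set.mem_preimage, Set.mem_singleton_iff, funext_iff, partitionJoin,
      ← hw', Fin.forall_iff, Nat.lt_succ_iff]
    rfl
  rw [e] at h
  rw [measureReal_def, h, ENNReal.toReal_ofReal (parryWeight_nonneg hP hA hlam _ _), parryWeight,
    chainWeight, Finset.prod_range]
  congr 1
  refine Finset.prod_congr rfl fun i _ => ?_
  rw [← hw', ← hw']
  rfl

/-- The preimage of a cylinder splits according to the preceding letter, and stationarity resums the
weights. Sets determined by central blocks are finite unions of cylinders and form a generating
π-system. -/
theorem HasParryLaw.measurePreserving (hC : IsSymbolicCoding A T agree b L)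
    (hP : IsPerronData A lam u v) (hA : ∀ i j, 0 ≤ A i j) (hlam : 0 < lam) {m : Measure X}
    (hm : HasParryLaw A lam u v T b m) : MeasurePreserving T m m := by
  have hprob := hm.isProbabilityMeasure hC hP
  have hword : ∀ n k (w : Fin k → Fin s), m (T ⁻¹' (partitionJoin T (b n) k ⁻¹' {w})) =
      m (partitionJoin T (b n) k ⁻¹' {w}) := by
    intro n k w
    cases k with
    | zero =>
      have : partitionJoin T (b n) 0 ⁻¹' {w} = Set.univ :=
        Set.eq_univ_of_forall fun x => Subsingleton.elim _ _
      rw [this, Set.preimage_univ]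
    | succ k =>
      let w' : ℕ → Fin s := fun i => w (Fin.ofNat (k + 1) i)
      have hw' : ∀ i : Fin (k + 1), w' i = w i := by
        intro i
        simp [w']
      have e : partitionJoin T (b n) (k + 1) ⁻¹' {w} = {x | ∀ i ≤ k, b n (T^[i] x) = w' i} := by
        ext x
        simp only [Set.mem_preimage, Set.mem_singleton_iff, funext_iff, partitionJoin,
          ← hw', Fin.forall_iff, Nat.lt_succ_iff]
        rfl
      have hmeas : MeasurableSet (T ⁻¹' {x | ∀ i ≤ k, b n (T^[i] x) = w' i}) :=
        hC.measurable_map (e ▸ hC.measurable_block n _ (measurableSet_singleton w))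
      rw [e, hm]
      have hsplit : m (T ⁻¹' {x | ∀ i ≤ k, b n (T^[i] x) = w' i}) =
          ∑ a, m {x | ∀ i ≤ k + 1, b n (T^[i] x) = Nat.casesOn i a w'} := by
        rw [measure_eq_sum_inter_fiber m (hC.measurable_letter n)]
        refine Finset.sum_congr rfl fun a _ => ?_
        congr 1
        ext x
        constructor
        · rintro ⟨h2, h3⟩ i hi
          cases i with
          | zero => exact h2
          | succ i => exact h3 i (by omega)
        · intro h2
          exact ⟨h2 0 (by omega), fun i hi => h2 (i + 1) (by omega)⟩
      rw [hsplit]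
      simp only [hm n]
      rw [← ENNReal.ofReal_sum_of_nonneg fun a _ => parryWeight_nonneg hP hA hlam _ _,
        sum_parryWeight_cons hP hlam]
  refine ⟨hC.measurable_map, ?_⟩
  have := Measure.isProbabilityMeasure_map (μ := m) hC.measurable_map.aemeasurable
  refine ext_of_generate_finite _ hC.generateFrom_saturated
    (fun t ht t' ht' _ => hC.isSetAlgebra_saturated.inter_mem ht ht') ?_ (by simp)
  rintro t ⟨n, ht⟩
  obtain ⟨φ, hφ⟩ := hC.exists_eq_comp_block (n := n) (g := fun x => x ∈ t)
    fun x y h => propext (ht x y h)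
  classical
  have et : t = partitionJoin T (b n) (L n) ⁻¹' ((Finset.univ.filter φ : Finset _) : Set _) := by
    ext x
    have := hφ x
    simp only [Finset.coe_filter, Finset.mem_univ, true_and, Set.mem_preimage]
    exact Eq.to_iff this
  have hmb : ∀ w, MeasurableSet (partitionJoin T (b n) (L n) ⁻¹' {w}) := fun w =>
    hC.measurable_block n _ (measurableSet_singleton w)
  rw [et, ← sum_measure_preimage_singleton _ fun w _ => hmb w,
    ← sum_measure_preimage_singleton _ fun w _ => hmb w]
  refine Finset.sum_congr rfl fun w _ => ?_
  rw [Measure.map_apply hC.measurable_map (hmb w), hword]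

theorem HasParryLaw.measureReal_letter {m : Measure X}
    (hP : IsPerronData A lam u v)
    (hA : ∀ i j, 0 ≤ A i j) (hlam : 0 < lam) (hm : HasParryLaw A lam u v T b m) (i : Fin s) :
    m.real (b 0 ⁻¹' {i}) = parryInit u v i := by
  have := hm.measureReal_block hP hA hlam 0 (k := 0) (fun _ => i)
  simp only [chainWeight, Finset.univ_eq_empty, Finset.prod_empty, mul_one] at this
  rw [← this]
  congr 1
  ext x
  simp [partitionJoin, funext_iff]

/-- For μ = m the word law is the Parry chain itself, so the relative entropy is zero. -/
theorem HasParryLaw.entropy_increment (hC : IsSymbolicCoding A T agree b L) {m : Measure X}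
    (hP : IsPerronData A lam u v)
    (hA : ∀ i j, 0 ≤ A i j) (hlam : 0 < lam) (hm : HasParryLaw A lam u v T b m) (k : ℕ) :
    partitionEntropy m (partitionJoin T (b 0) (k + 1)) -
      partitionEntropy m (partitionJoin T (b 0) 1) = k * Real.log lam := by
  have hprob := hm.isProbabilityMeasure hC hP
  have h := (hC.relEntropy_chainWeight hP hlam (hm.measurePreserving hC hP hA hlam) k).1
  simp only [hm.measureReal_block hP hA hlam, hm.measureReal_letter hP hA hlam, sub_self,
    mul_zero, Finset.sum_const_zero] at h
  linarith

/-- The letter partition competes in the supremum and its words have entropy growing at rate log λ.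
Finiteness of the supremum is needed because `toReal` sends ⊤ to 0. -/
theorem HasParryLaw.log_le_toReal_measureEntropy (hC : IsSymbolicCoding A T agree b L)
    {m : Measure X} (hP : IsPerronData A lam u v)
    (hA : ∀ i j, 0 ≤ A i j) (hlam : 0 < lam) (hm : HasParryLaw A lam u v T b m) :
    Real.log lam ≤ (measureEntropy T m).toReal := by
  have hprob := hm.isProbabilityMeasure hC hP
  have hmp := hm.measurePreserving hC hP hA hlam
  have hfin : measureEntropy T m ≠ ⊤ :=
    ne_top_of_le_ne_top ENNReal.ofReal_ne_top (hC.measureEntropy_le hmp Nat.one_pos)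
  have hlow : ENNReal.ofReal (Real.log lam) ≤ measureEntropy T m := by
    refine le_trans ?_ (le_iSup_of_le s (le_iSup_of_le (b 0)
      (le_iSup_of_le (hC.measurable_letter 0) le_rfl)))
    have hlim : Tendsto (fun n : ℕ => ENNReal.ofReal
        (partitionEntropy m (partitionJoin T (b 0) n) / n)) atTop
        (nhds (ENNReal.ofReal (Real.log lam))) := by
      refine ENNReal.tendsto_ofReal ?_
      have h1 := (tendsto_const_div_atTop_nhds_zero_nat
        (partitionEntropy m (partitionJoin T (b 0) 1) - Real.log lam)).const_add (Real.log lam)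
      rw [add_zero] at h1
      refine h1.congr' ((eventually_ge_atTop 1).mono fun n hn => ?_)
      obtain ⟨k, rfl⟩ := Nat.exists_eq_add_of_le' hn
      have h2 := hm.entropy_increment hC hP hA hlam k
      have h3 : ((k + 1 : ℕ) : ℝ) ≠ 0 := by positivity
      rw [eq_div_iff h3, add_mul, div_mul_cancel₀ _ h3]
      push_cast
      linarith
    exact hlim.limsup_eq.ge
  exact (le_max_left _ _).trans (by
    rw [← ENNReal.toReal_ofReal']; exact ENNReal.toReal_mono hfin hlow)

/-- Pinsker for the relative entropy k log λ − (H_{k+1} − H_1), which is at most k (h_m − h_μ) since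
log λ ≤ h_m and k h_μ ≤ H_{k+1} − H_1. -/
theorem sum_abs_measureReal_sub_chainWeight_le (hC : IsSymbolicCoding A T agree b L)
    {m : Measure X} (hP : IsPerronData A lam u v)
    (hA : ∀ i j, 0 ≤ A i j) (hlam : 0 < lam) (hm : HasParryLaw A lam u v T b m)
    {μ : Measure X} [IsProbabilityMeasure μ] (hT : MeasurePreserving T μ μ) (k : ℕ) :
    ∑ w : Fin (k + 1) → Fin s, |μ.real (partitionJoin T (b 0) (k + 1) ⁻¹' {w}) -
      chainWeight A lam v (fun i => μ.real (b 0 ⁻¹' {i})) w| ≤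
      2 * (k * √((measureEntropy T m).toReal - (measureEntropy T μ).toReal)) := by
  obtain ⟨h1, h2⟩ := hC.relEntropy_chainWeight hP hlam hT k
  have hpin := sum_abs_sub_le_two_mul_sqrt_relEntropy _ _ (fun _ => measureReal_nonneg)
    (fun w => chainWeight_nonneg hP hA hlam (fun _ => measureReal_nonneg) w) h2
    (sum_measureReal_fiber μ (hC.measurable_block 0 (k + 1)))
    ((sum_chainWeight hP hlam _ k).trans (sum_measureReal_fiber μ (hC.measurable_letter 0)))
  rw [h1] at hpin
  refine hpin.trans (mul_le_mul_of_nonneg_left ?_ zero_le_two)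
  rcases Nat.eq_zero_or_pos k with rfl | hk
  · simp
  have hk' : (1 : ℝ) ≤ k := by exact_mod_cast hk
  have hm1 := hm.log_le_toReal_measureEntropy hC hP hA hlam
  have hc : (measureEntropy T μ).toReal ≤ (partitionEntropy μ (partitionJoin T (b 0) (k + 1)) -
      partitionEntropy μ (partitionJoin T (b 0) 1)) / k := by
    refine ENNReal.toReal_le_of_le_ofReal (div_nonneg (sub_nonneg.2 ?_) (by positivity))
      (hC.measureEntropy_le hT hk)
    refine partitionEntropy_le_of_factor μ (hC.measurable_block 0 _) fun x y h => ?_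
    rw [partitionJoin_eq_iff] at h ⊢
    exact fun i hi => h i (by omega)
  rw [le_div_iff₀ (by positivity)] at hc
  -- The natural factor √k is weakened to k, which is linear in the word length and harmless against
  -- θ^{-n}.
  calc _ ≤ √(k ^ 2 * ((measureEntropy T m).toReal - (measureEntropy T μ).toReal)) := by
        rcases le_or_gt 0 (k * Real.log lam -
            (partitionEntropy μ (partitionJoin T (b 0) (k + 1)) -
              partitionEntropy μ (partitionJoin T (b 0) 1))) with h | h
        · refine Real.sqrt_le_sqrt ?_
          have h3 : k * Real.log lam - (partitionEntropy μ (partitionJoin T (b 0) (k + 1)) -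
              partitionEntropy μ (partitionJoin T (b 0) 1)) ≤
              k * ((measureEntropy T m).toReal - (measureEntropy T μ).toReal) := by
            nlinarith
          have h4 : 0 ≤ k * ((measureEntropy T m).toReal - (measureEntropy T μ).toReal) :=
            h.trans h3
          nlinarith
        · rw [Real.sqrt_eq_zero_of_nonpos h.le]
          exact Real.sqrt_nonneg _
    _ = _ := by rw [Real.sqrt_mul (by positivity), Real.sqrt_sq (by positivity)]

/-- The laws of blocks of length `l` under `μ` and the Parry measure differ by at most a multiple
of `l (h_m - h_μ) ^ (1 / 2)`. -/
theorem exists_sum_abs_block_sub_le [NeZero s] (hC : IsSymbolicCoding A T agree b L)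
    (hirr : A.IsIrreducible) {m : Measure X} (hP : IsPerronData A lam u v)
    (hlam : 0 < lam) (hm : HasParryLaw A lam u v T b m) :
    ∃ C : ℝ, 0 ≤ C ∧ ∀ μ : Measure X, IsProbabilityMeasure μ → MeasurePreserving T μ μ →
      ∀ n l : ℕ, ∑ w : Fin l → Fin s, |μ.real (partitionJoin T (b n) l ⁻¹' {w}) -
        m.real (partitionJoin T (b n) l ⁻¹' {w})| ≤
        C * (l * √((measureEntropy T m).toReal - (measureEntropy T μ).toReal)) := by
  have hA := hirr.nonneg
  have hprob := hm.isProbabilityMeasure hC hP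
  obtain ⟨C, hC0, hCx⟩ := exists_sum_abs_le_sum_abs_defect hirr hP hlam
  refine ⟨2 + 2 * C, by positivity, fun μ _ hT n l => ?_⟩
  set E := √((measureEntropy T m).toReal - (measureEntropy T μ).toReal) with hE
  have hE0 : 0 ≤ E := Real.sqrt_nonneg _
  set π : Fin s → ℝ := fun i => μ.real (b 0 ⁻¹' {i}) with hπ
  have hπsum : ∑ i, π i = 1 := sum_measureReal_fiber μ (hC.measurable_letter 0)
  cases l with
  | zero =>
    have : ∀ w, partitionJoin T (b n) 0 ⁻¹' {w} = Set.univ := fun w =>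
      Set.eq_univ_of_forall fun x => Subsingleton.elim _ _
    simp [this]
  | succ k =>
    have hk := fun k => hC.sum_abs_measureReal_sub_chainWeight_le hP hA hlam hm hT k
    -- Two-letter words: the second letter has law π under μ by invariance and law πP under the
    -- chain, and passing to a marginal does not increase the ℓ¹ distance.
    have hdefect : ∑ j, |π j - ∑ i, π i * parryTrans A lam v i j| ≤ 2 * E := by
      have h1 := hk 1
      rw [Nat.cast_one, one_mul] at h1
      refine le_trans ?_ h1
      rw [← (finTwoArrowEquiv (Fin s)).symm.sum_comp, Fintype.sum_prod_type_right]
      refine Finset.sum_le_sum fun j _ => ?_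
      have e1 : π j = ∑ i, μ.real (partitionJoin T (b 0) (1 + 1) ⁻¹'
          {(finTwoArrowEquiv (Fin s)).symm (i, j)}) := by
        have h2 : π j = μ.real ((fun x => b 0 (T x)) ⁻¹' {j}) :=
          (hT.measureReal_preimage
            (hC.measurable_letter 0 (measurableSet_singleton j)).nullMeasurableSet).symm
        rw [h2, measureReal_fst_fiber μ (hC.measurable_letter 0)]
        refine Finset.sum_congr rfl fun i _ => ?_
        congr 1
        ext x
        simp [partitionJoin, funext_iff, Fin.forall_fin_two, and_comm]
      have e2 : ∑ i, π i * parryTrans A lam v i j =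
          ∑ i, chainWeight A lam v π ((finTwoArrowEquiv (Fin s)).symm (i, j)) := by
        refine Finset.sum_congr rfl fun i _ => ?_
        simp [chainWeight]
      rw [e1, e2, ← Finset.sum_sub_distrib]
      exact Finset.abs_sum_le_sum_abs _ _
    have hletter : ∑ i, |π i - parryInit u v i| ≤ C * (2 * E) := by
      refine (hCx (fun i => π i - parryInit u v i) ?_).trans
        (mul_le_mul_of_nonneg_left ?_ hC0)
      · rw [Finset.sum_sub_distrib, hπsum]
        simp [parryInit, hP.normalized]
      · refine le_trans (Finset.sum_le_sum fun j _ => le_of_eq ?_) hdefect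
        congr 1
        simp only [sub_mul, Finset.sum_sub_distrib, sum_parryInit_mul_parryTrans hP hlam j]
        ring
    simp only [hC.measureReal_block hT n, hm.measureReal_block hP hA hlam n]
    -- Triangle inequality through the chain started from π. The two parts cost 2kE and 2CE, both
    -- covered by (2 + 2C)(k + 1)E.
    have h3 : ∀ w, |μ.real (partitionJoin T (b 0) (k + 1) ⁻¹' {w}) -
        chainWeight A lam v (parryInit u v) w| ≤
        |μ.real (partitionJoin T (b 0) (k + 1) ⁻¹' {w}) - chainWeight A lam v π w| +
        |chainWeight A lam v π w - chainWeight A lam v (parryInit u v) w| := fun w =>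
      abs_sub_le _ _ _
    refine (Finset.sum_le_sum fun w _ => h3 w).trans ?_
    rw [Finset.sum_add_distrib, sum_abs_chainWeight_sub hP hA hlam]
    have h4 := hk k
    push_cast
    have h5 : 0 ≤ C * k * E := by positivity
    nlinarith

end IsSymbolicCoding

/-! ### Lipschitz functions -/

namespace IsSymbolicCoding

variable {s : ℕ} {A : Matrix (Fin s) (Fin s) ℝ} {X : Type*} [mX : MeasurableSpace X]
  {T : X → X} {agree : ℕ → X → X → Prop} {b : ℕ → X → Fin s} {L : ℕ → ℕ}

theorem agree_zero (hC : IsSymbolicCoding A T agree b L) (x y : X) : agree 0 x y := by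
  rw [hC.agree_iff, partitionJoin_eq_iff, hC.length_zero]
  simp

theorem symbolicDist_le (hC : IsSymbolicCoding A T agree b L) {θ : ℝ} (hθ : 1 < θ) {n : ℕ} {x y : X}
    (h : agree n x y) : symbolicDist agree θ x y ≤ (θ ^ n)⁻¹ := by
  have hθ0 : 0 < θ := by linarith
  unfold symbolicDist
  split_ifs with hxy
  · positivity
  -- Distinct points disagree at some order, so the set of orders of agreement is bounded; on an
  -- unbounded set of naturals `sSup` would be 0.
  · obtain ⟨N, hN⟩ : ∃ N, ¬ agree N x y := by
      by_contra! hcon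
      exact hxy (hC.eq_of_agree x y hcon)
    have hbdd : BddAbove {n : ℕ | agree n x y} := by
      refine ⟨N, fun k hk => ?_⟩
      by_contra! hlt
      exact hN (hC.agree_mono hlt.le hk)
    exact inv_anti₀ (pow_pos hθ0 n) (pow_le_pow_right₀ hθ.le (le_csSup hbdd h))

/-- The Lipschitz hypothesis bounds the sets under the suprema defining var_n and the seminorm, so
that these real suprema are genuine and not the default 0. -/
theorem abs_sub_le_symbolicSeminorm (hC : IsSymbolicCoding A T agree b L) {θ : ℝ} (hθ : 1 < θ)
    {f : X → ℝ} (hf : IsSymbolicLipschitz agree θ f) {n : ℕ} {x y : X} (h : agree n x y) :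
    |f x - f y| ≤ symbolicSeminorm agree θ f * (θ ^ n)⁻¹ := by
  have hθ0 : 0 < θ := by linarith
  obtain ⟨K, hK⟩ := hf
  have hbound : ∀ k x y, agree k x y → |f x - f y| ≤ |K| * (θ ^ k)⁻¹ := by
    intro k x y hk
    have hd : 0 ≤ symbolicDist agree θ x y := by
      unfold symbolicDist
      split_ifs <;> positivity
    calc |f x - f y| ≤ K * symbolicDist agree θ x y := hK x y
      _ ≤ |K| * symbolicDist agree θ x y := mul_le_mul_of_nonneg_right (le_abs_self K) hd
      _ ≤ _ := mul_le_mul_of_nonneg_left (hC.symbolicDist_le hθ hk) (abs_nonneg K)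
  have hvar : ∀ k, symbolicVar agree f k ≤ |K| * (θ ^ k)⁻¹ := by
    intro k
    refine Real.sSup_le ?_ (by positivity)
    rintro _ ⟨x, y, hk, rfl⟩
    exact hbound k x y hk
  have h1 : |f x - f y| ≤ symbolicVar agree f n := by
    refine le_csSup ⟨|K| * (θ ^ n)⁻¹, ?_⟩ ⟨x, y, h, rfl⟩
    rintro _ ⟨x, y, hk, rfl⟩
    exact hbound n x y hk
  have h2 : symbolicVar agree f n / (θ ^ n)⁻¹ ≤ symbolicSeminorm agree θ f := by
    refine le_ciSup (f := fun n : ℕ => symbolicVar agree f n / (θ ^ n)⁻¹) ⟨|K|, ?_⟩ n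
    rintro _ ⟨k, rfl⟩
    exact (div_le_iff₀ (by positivity)).2 (hvar k)
  exact h1.trans ((div_le_iff₀ (by positivity)).1 h2)

theorem symbolicSeminorm_nonneg {Y : Type*} {agree : ℕ → Y → Y → Prop} {θ : ℝ} (hθ : 1 < θ)
    (f : Y → ℝ) :
    0 ≤ symbolicSeminorm agree θ f := by
  refine Real.iSup_nonneg fun n => div_nonneg (Real.sSup_nonneg ?_) ?_
  · rintro _ ⟨x, y, _, rfl⟩
    exact abs_nonneg _
  · have : 0 < θ := by linarith
    positivity

theorem abs_integral_sub_le_of_agree (hC : IsSymbolicCoding A T agree b L) {μ m : Measure X}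
    [IsFiniteMeasure μ] [IsFiniteMeasure m] {n : ℕ} {g : X → ℝ} {B : ℝ}
    (hg : ∀ x y, agree n x y → g x = g y) (hB : ∀ x, |g x| ≤ B) :
    |∫ x, g x ∂μ - ∫ x, g x ∂m| ≤ B * ∑ w : Fin (L n) → Fin s,
      |μ.real (partitionJoin T (b n) (L n) ⁻¹' {w}) -
        m.real (partitionJoin T (b n) (L n) ⁻¹' {w})| := by
  obtain ⟨φ, hφ⟩ := hC.exists_eq_comp_block hg
  simp only [hφ] at hB ⊢
  rw [integral_comp_eq_sum μ (hC.measurable_block n (L n)) φ,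
    integral_comp_eq_sum m (hC.measurable_block n (L n)) φ, ← Finset.sum_sub_distrib,
    Finset.mul_sum]
  refine (Finset.abs_sum_le_sum_abs _ _).trans (Finset.sum_le_sum fun w _ => ?_)
  rw [← sub_mul, abs_mul, mul_comm]
  -- Nothing bounds φ at words that no point realises, but there both measures vanish.
  rcases (partitionJoin T (b n) (L n) ⁻¹' {w}).eq_empty_or_nonempty with h | ⟨x, hx⟩
  · simp [h]
  · rw [Set.mem_preimage, Set.mem_singleton_iff] at hx
    exact mul_le_mul_of_nonneg_right (hx ▸ hB x) (abs_nonneg _)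

/-- Sampling a function on each central block of order `n`. -/
theorem exists_block_approx (hC : IsSymbolicCoding A T agree b L) (f : X → ℝ) (n : ℕ) :
    ∃ g : X → ℝ, (∀ x y, agree n x y → g x = g y) ∧
      ∀ x, ∃ y, agree n x y ∧ g x = f y := by
  classical
  -- The default x only makes r total, with no point of X to choose beforehand; it is never taken at
  -- the word of an actual point.
  let r : (Fin (L n) → Fin s) → X → X := fun w x =>
    if h : ∃ y, partitionJoin T (b n) (L n) y = w then h.choose else x
  have hr : ∀ x z, partitionJoin T (b n) (L n) (r (partitionJoin T (b n) (L n) x) z) =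
      partitionJoin T (b n) (L n) x := by
    intro x z
    have h : ∃ y, partitionJoin T (b n) (L n) y = partitionJoin T (b n) (L n) x := ⟨x, rfl⟩
    simp only [r, h, dif_pos]
    exact h.choose_spec
  refine ⟨fun x => f (r (partitionJoin T (b n) (L n) x) x), fun x y hxy => ?_, fun x =>
    ⟨_, (hC.agree_iff n _ _).2 (hr x x).symm, rfl⟩⟩
  have h : ∃ z, partitionJoin T (b n) (L n) z = partitionJoin T (b n) (L n) y := ⟨y, rfl⟩
  simp only [(hC.agree_iff n x y).1 hxy, r, h, dif_pos]

/-- Integrals of Lipschitz functions are controlled by the laws of blocks. -/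
theorem exists_abs_integral_sub_le (hC : IsSymbolicCoding A T agree b L) {θ : ℝ} (hθ : 1 < θ) :
    ∃ K : ℝ, 0 < K ∧ ∀ (μ m : Measure X), IsProbabilityMeasure μ → IsProbabilityMeasure m →
      ∀ D : ℝ, 0 ≤ D → (∀ n l : ℕ, ∑ w : Fin l → Fin s,
        |μ.real (partitionJoin T (b n) l ⁻¹' {w}) - m.real (partitionJoin T (b n) l ⁻¹' {w})| ≤
          l * D) →
      ∀ f : X → ℝ, IsSymbolicLipschitz agree θ f →
        |∫ x, f x ∂μ - ∫ x, f x ∂m| ≤ K * symbolicSeminorm agree θ f * D := by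
  have hθ0 : 0 < θ := by linarith
  have hθ1 : θ⁻¹ < 1 := inv_lt_one_of_one_lt₀ hθ
  have hsum : Summable fun n : ℕ => ((n : ℝ) + 1) * θ⁻¹ ^ n := by
    have hnorm : ‖θ⁻¹‖ < 1 := by
      rwa [Real.norm_of_nonneg (by positivity)]
    have h1 := summable_pow_mul_geometric_of_norm_lt_one 1 hnorm
    have h2 := summable_geometric_of_norm_lt_one hnorm
    refine (h1.add h2).congr fun n => ?_
    ring
  have hpos : 0 ≤ ∑' n : ℕ, ((n : ℝ) + 1) * θ⁻¹ ^ n := tsum_nonneg fun n => by positivity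
  -- The n-th increment of the block approximations has size S θ^{-n} and sees at most 2(n + 1)
  -- letters; the final 1 makes positivity immediate.
  refine ⟨2 * ∑' n : ℕ, ((n : ℝ) + 1) * θ⁻¹ ^ n + 1, by positivity,
    fun μ m _ _ D hD hblock f hf => ?_⟩
  set S := symbolicSeminorm agree θ f with hS
  have hS0 : 0 ≤ S := symbolicSeminorm_nonneg hθ f
  choose g hg hgf using fun n => hC.exists_block_approx f n
  have hXne : Nonempty X := by
    by_contra h
    rw [not_nonempty_iff] at h
    have := measure_univ (μ := μ)
    simp [Set.eq_empty_of_isEmpty] at this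
  obtain ⟨x₀⟩ := hXne
  have hlip : ∀ n x y, agree n x y → |f x - f y| ≤ S * (θ ^ n)⁻¹ := fun n x y h =>
    hC.abs_sub_le_symbolicSeminorm hθ hf h
  have hstep : ∀ n x, |g (n + 1) x - g n x| ≤ S * (θ ^ n)⁻¹ := by
    intro n x
    obtain ⟨y, hy, hy'⟩ := hgf (n + 1) x
    obtain ⟨z, hz, hz'⟩ := hgf n x
    rw [hy', hz']
    exact hlip n y z (hC.agree_trans (hC.agree_symm (hC.agree_of_succ n x y hy)) hz)
  have hbound : ∀ n x, |g n x| ≤ |f x₀| + S := by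
    intro n x
    obtain ⟨y, -, hy⟩ := hgf n x
    have h := hlip 0 y x₀ (hC.agree_zero y x₀)
    rw [pow_zero, inv_one, mul_one] at h
    rw [hy]
    have := abs_sub_abs_le_abs_sub (f y) (f x₀)
    linarith
  have hmeas : ∀ n, Measurable (g n) := fun n => hC.measurable_of_agree (hg n)
  have hint : ∀ (ν : Measure X) [IsFiniteMeasure ν] n, Integrable (g n) ν := fun ν _ n =>
    Integrable.of_bound (hmeas n).aestronglyMeasurable (|f x₀| + S)
      (Eventually.of_forall fun x => hbound n x)
  have hlim : ∀ (ν : Measure X) [IsFiniteMeasure ν],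
      Tendsto (fun n => ∫ x, g n x ∂ν) atTop (nhds (∫ x, f x ∂ν)) := by
    intro ν _
    refine tendsto_integral_of_dominated_convergence (fun _ => |f x₀| + S)
      (fun n => (hmeas n).aestronglyMeasurable) (integrable_const _)
      (fun n => Eventually.of_forall fun x => hbound n x) (Eventually.of_forall fun x => ?_)
    rw [tendsto_iff_norm_sub_tendsto_zero]
    refine squeeze_zero (fun _ => norm_nonneg _) (g := fun n => S * θ⁻¹ ^ n) (fun n => ?_) ?_
    · obtain ⟨y, hy, hy'⟩ := hgf n x
      rw [hy', Real.norm_eq_abs, inv_pow]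
      exact hlip n y x (hC.agree_symm hy)
    · simpa using (tendsto_pow_atTop_nhds_zero_of_lt_one (by positivity) hθ1).const_mul S
  -- The telescoping starts from g 0, which is constant and so has the same integral under both
  -- probability measures.
  have hpartial : ∀ N, |∫ x, g N x ∂μ - ∫ x, g N x ∂m| ≤
      2 * S * D * ∑ n ∈ Finset.range N, ((n : ℝ) + 1) * θ⁻¹ ^ n := by
    intro N
    induction N with
    | zero =>
      have : ∀ x, g 0 x = g 0 x₀ := fun x => hg 0 x x₀ (hC.agree_zero x x₀)
      simp [this]
    | succ N ih =>
      have h1 := hC.abs_integral_sub_le_of_agree (μ := μ) (m := m) (n := N + 1)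
        (g := fun x => g (N + 1) x - g N x) (B := S * (θ ^ N)⁻¹)
        (fun x y h => by
          rw [hg (N + 1) x y h, hg N x y (hC.agree_of_succ N x y h)])
        (hstep N)
      rw [integral_sub (hint μ _) (hint μ _), integral_sub (hint m _) (hint m _)] at h1
      have h2 : ((L (N + 1) : ℕ) : ℝ) * D ≤ 2 * (N + 1) * D := by
        refine mul_le_mul_of_nonneg_right ?_ hD
        exact_mod_cast hC.length_le (N + 1)
      have h3 := h1.trans (mul_le_mul_of_nonneg_left ((hblock (N + 1) (L (N + 1))).trans h2)
        (by positivity))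
      have h4 := abs_add_le (∫ x, g N x ∂μ - ∫ x, g N x ∂m)
        (∫ x, g (N + 1) x ∂μ - ∫ x, g N x ∂μ - (∫ x, g (N + 1) x ∂m - ∫ x, g N x ∂m))
      rw [show (∫ x, g N x ∂μ - ∫ x, g N x ∂m) +
        (∫ x, g (N + 1) x ∂μ - ∫ x, g N x ∂μ - (∫ x, g (N + 1) x ∂m - ∫ x, g N x ∂m)) =
        ∫ x, g (N + 1) x ∂μ - ∫ x, g (N + 1) x ∂m by ring] at h4
      rw [Finset.sum_range_succ, inv_pow]
      calc _ ≤ _ := h4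
        _ ≤ _ := add_le_add ih h3
        _ = _ := by ring
  refine le_of_tendsto ((hlim μ).sub (hlim m)).abs (Eventually.of_forall fun N => ?_)
  refine (hpartial N).trans ?_
  have h1 := hsum.sum_le_tsum (Finset.range N) fun n _ => by positivity
  have h2 : 0 ≤ S * D := by positivity
  nlinarith [mul_le_mul_of_nonneg_left h1 h2]

/-- Effective uniqueness of the Parry measure for a symbolic coding. -/
theorem exists_abs_integral_sub_parry_le [NeZero s] (hC : IsSymbolicCoding A T agree b L)
    (hirr : A.IsIrreducible) {lam : ℝ} {u v : Fin s → ℝ} {m : Measure X}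
    (hP : IsPerronData A lam u v) (hlam : 0 < lam) (hm : HasParryLaw A lam u v T b m)
    {θ : ℝ} (hθ : 1 < θ) :
    ∃ c : ℝ, 0 < c ∧ ∀ μ : Measure X, IsProbabilityMeasure μ → MeasurePreserving T μ μ →
      ∀ f : X → ℝ, IsSymbolicLipschitz agree θ f →
        |∫ x, f x ∂μ - ∫ x, f x ∂m| ≤ c * symbolicSeminorm agree θ f *
          √((measureEntropy T m).toReal - (measureEntropy T μ).toReal) := by
  have hprob := hm.isProbabilityMeasure hC hP
  obtain ⟨C, hC0, hCb⟩ := hC.exists_sum_abs_block_sub_le hirr hP hlam hm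
  obtain ⟨K, hK0, hK⟩ := hC.exists_abs_integral_sub_le hθ
  refine ⟨K * (C + 1), by positivity, fun μ hμ hT f hf => ?_⟩
  have hE := Real.sqrt_nonneg ((measureEntropy T m).toReal - (measureEntropy T μ).toReal)
  have h := hK μ m hμ hprob
    (C * √((measureEntropy T m).toReal - (measureEntropy T μ).toReal)) (by positivity)
    (fun n l => (hCb μ hμ hT n l).trans (le_of_eq (by ring))) f hf
  have hS := symbolicSeminorm_nonneg (agree := agree) hθ f
  refine h.trans ?_
  have : 0 ≤ K * (symbolicSeminorm agree θ f *
    √((measureEntropy T m).toReal - (measureEntropy T μ).toReal)) := by positivity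
  nlinarith

end IsSymbolicCoding

/-! ### The Perron–Frobenius theorem -/

section Perron

variable {s : ℕ} {A : Matrix (Fin s) (Fin s) ℝ}

/-- A sum of powers of A, containing for each pair (i, j) one whose (i, j) entry is positive. -/
theorem exists_pos_commuting (hirr : A.IsIrreducible) :
    ∃ M : Matrix (Fin s) (Fin s) ℝ, (∀ i j, 0 < M i j) ∧ A * M = M * A := by
  choose n hn hpos using (Matrix.isIrreducible_iff_exists_pow_pos hirr.nonneg).1 hirr
  let S : Finset ℕ := Finset.univ.image fun p : Fin s × Fin s => n p.1 p.2
  refine ⟨∑ k ∈ S, A ^ k, fun i j => ?_, ?_⟩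
  · rw [Matrix.sum_apply]
    exact Finset.sum_pos' (fun k _ => Matrix.pow_apply_nonneg hirr.nonneg k i j)
      ⟨n i j, Finset.mem_image.2 ⟨(i, j), Finset.mem_univ _, rfl⟩, hpos i j⟩
  · exact (Commute.sum_right S (fun k => A ^ k) A fun k _ => Commute.self_pow A k).eq

theorem mulVec_pos_of_pos {M : Matrix (Fin s) (Fin s) ℝ} (hM : ∀ i j, 0 < M i j)
    {x : Fin s → ℝ} (hx : ∀ i, 0 ≤ x i) (hx0 : x ≠ 0) (i : Fin s) : 0 < M.mulVec x i := by
  obtain ⟨j, hj⟩ := Function.ne_iff.1 hx0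
  exact Finset.sum_pos' (fun k _ => mul_nonneg (hM i k).le (hx k))
    ⟨j, Finset.mem_univ j, mul_pos (hM i j) ((hx j).lt_of_ne (Ne.symm hj))⟩

/-- An irreducible matrix has a strictly positive eigenvector. -/
theorem exists_pos_eigenvector [NeZero s] (hirr : A.IsIrreducible) :
    ∃ (t : ℝ) (x : Fin s → ℝ), (∀ i, 0 < x i) ∧ A.mulVec x = t • x := by
  obtain ⟨M, hM, hcomm⟩ := exists_pos_commuting hirr
  let B : ℝ := ∑ i, ∑ j, A i j
  have hx1 : ∀ x ∈ stdSimplex ℝ (Fin s), ∀ i, x i ≤ 1 := fun x hx i => by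
    rw [← hx.2]
    exact Finset.single_le_sum (fun j _ => hx.1 j) (Finset.mem_univ i)
  -- Collatz–Wielandt: maximise t over the pairs with t x ≤ A x and x in the simplex. Summing the
  -- inequality bounds t by the sum B of all entries, hence compactness.
  let S : Set (ℝ × (Fin s → ℝ)) :=
    (Set.Icc 0 B ×ˢ stdSimplex ℝ (Fin s)) ∩ {p | ∀ i, p.1 * p.2 i ≤ A.mulVec p.2 i}
  have hScomp : IsCompact S := by
    refine (isCompact_Icc.prod (isCompact_stdSimplex ℝ (Fin s))).inter_right ?_
    simp only [Set.ofPred_forall]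
    refine isClosed_iInter fun i => isClosed_le (by fun_prop) ?_
    simp only [Matrix.mulVec, dotProduct]
    fun_prop
  have hSmem : ∀ t x, 0 ≤ t → x ∈ stdSimplex ℝ (Fin s) → (∀ i, t * x i ≤ A.mulVec x i) →
      (t, x) ∈ S := by
    intro t x ht hx hle
    refine ⟨⟨⟨ht, ?_⟩, hx⟩, hle⟩
    calc t = ∑ i, t * x i := by rw [← Finset.mul_sum, hx.2, mul_one]
      _ ≤ ∑ i, A.mulVec x i := Finset.sum_le_sum fun i _ => hle i
      _ ≤ B := by
        simp only [Matrix.mulVec, dotProduct]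
        exact Finset.sum_le_sum fun i _ => Finset.sum_le_sum fun j _ =>
          mul_le_of_le_one_right (hirr.nonneg i j) (hx1 x hx j)
  have hSne : S.Nonempty := by
    refine ⟨(0, Pi.single 0 1), hSmem _ _ le_rfl (single_mem_stdSimplex ℝ 0) fun i => ?_⟩
    simp only [zero_mul, Matrix.mulVec, dotProduct]
    exact Finset.sum_nonneg fun j _ => mul_nonneg (hirr.nonneg i j)
      ((single_mem_stdSimplex ℝ (0 : Fin s)).1 j)
  obtain ⟨⟨t, x⟩, ⟨⟨⟨ht0, -⟩, hx⟩, hle⟩, hmax⟩ :=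
    hScomp.exists_isMaxOn hSne continuous_fst.continuousOn
  simp only [Set.mem_ofPred_eq] at ht0 hx hle
  have hxne : x ≠ 0 := by
    rintro rfl
    simpa using hx.2
  have hy : ∀ i, 0 < M.mulVec x i := mulVec_pos_of_pos hM hx.1 hxne
  -- Otherwise applying M to the nonnegative nonzero vector Ax − tx makes the inequality strict in
  -- every coordinate for Mx, and normalising Mx allows a larger t.
  have heig : A.mulVec x = t • x := by
    by_contra hne
    have hz := mulVec_pos_of_pos hM (x := A.mulVec x - t • x)
      (fun i => by simpa using hle i) (sub_ne_zero.2 hne)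
    have hgap : ∀ i, t * M.mulVec x i < A.mulVec (M.mulVec x) i := by
      intro i
      have := hz i
      rw [Matrix.mulVec_sub, Matrix.mulVec_mulVec, ← hcomm, ← Matrix.mulVec_mulVec,
        Matrix.mulVec_smul] at this
      simpa using this
    set y := M.mulVec x with hydef
    obtain ⟨i₀, -, hi₀⟩ := Finset.exists_min_image Finset.univ (fun i => A.mulVec y i / y i)
      Finset.univ_nonempty
    have hlt : t < A.mulVec y i₀ / y i₀ := (lt_div_iff₀ (hy i₀)).2 (hgap i₀)
    have hsum : 0 < ∑ i, y i := Finset.sum_pos (fun i _ => hy i) Finset.univ_nonempty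
    have hmem := hSmem (A.mulVec y i₀ / y i₀) ((∑ i, y i)⁻¹ • y) (ht0.trans hlt.le)
      ⟨fun i => mul_nonneg (inv_nonneg.2 hsum.le) (hy i).le, by
        simp only [Pi.smul_apply, smul_eq_mul]
        rw [← Finset.mul_sum, inv_mul_cancel₀ hsum.ne']⟩ (fun i => by
        have h := (le_div_iff₀ (hy i)).1 (hi₀ i (Finset.mem_univ i))
        rw [Matrix.mulVec_smul, Pi.smul_apply, Pi.smul_apply, smul_eq_mul, smul_eq_mul,
          mul_left_comm]
        exact mul_le_mul_of_nonneg_left h (inv_nonneg.2 hsum.le))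
    exact absurd (hmax hmem) (not_le.2 hlt)
  refine ⟨t, x, fun i => ?_, heig⟩
  have hAy : A.mulVec (M.mulVec x) = t • M.mulVec x := by
    rw [Matrix.mulVec_mulVec, hcomm, ← Matrix.mulVec_mulVec, heig, Matrix.mulVec_smul]
  by_contra hxi
  have hxi0 : x i = 0 := le_antisymm (not_lt.1 hxi) (hx.1 i)
  have hpow : ∀ n : ℕ, (A ^ n).mulVec x = t ^ n • x := by
    intro n
    induction n with
    | zero => simp
    | succ n ih => rw [pow_succ, ← Matrix.mulVec_mulVec, heig, Matrix.mulVec_smul, ih, smul_smul,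
        pow_succ']
  obtain ⟨j, hj⟩ := Function.ne_iff.1 hxne
  obtain ⟨n, -, hn⟩ := (Matrix.isIrreducible_iff_exists_pow_pos hirr.nonneg).1 hirr i j
  have h := congrFun (hpow n) i
  rw [Pi.smul_apply, hxi0, smul_zero] at h
  exact (Finset.sum_pos' (fun k _ => mul_nonneg (Matrix.pow_apply_nonneg hirr.nonneg n i k)
    (hx.1 k)) ⟨j, Finset.mem_univ j, mul_pos hn ((hx.1 j).lt_of_ne (Ne.symm hj))⟩).ne' h

/-- Positive eigenvectors of A and of its transpose share their eigenvalue, because their pairing is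
positive. It is the largest one: an eigenvector w for t satisfies t|w| ≤ A|w|, and pairing with the
positive left eigenvector u gives t ≤ λ. -/
theorem exists_isPerronData [NeZero s] (hirr : A.IsIrreducible) :
    ∃ (lam : ℝ) (u v : Fin s → ℝ), IsPerronData A lam u v := by
  obtain ⟨lam, v, hv, hAv⟩ := exists_pos_eigenvector hirr
  obtain ⟨lam', u, hu, hAu⟩ := exists_pos_eigenvector hirr.transpose
  rw [Matrix.mulVec_transpose] at hAu
  have huv : 0 < ∑ i, u i * v i :=
    Finset.sum_pos (fun i _ => mul_pos (hu i) (hv i)) Finset.univ_nonempty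
  have hlam : lam' = lam := by
    have h := Matrix.dotProduct_mulVec u A v
    rw [hAv, hAu, dotProduct_smul, smul_dotProduct, smul_eq_mul, smul_eq_mul] at h
    exact (mul_right_cancel₀ (b := u ⬝ᵥ v) huv.ne' h).symm
  subst hlam
  set r := ∑ i, u i * v i with hr
  refine ⟨lam', r⁻¹ • u, v, ⟨⟨?_, ?_⟩, fun i => mul_pos (inv_pos.2 huv) (hu i), hv, ?_, hAv, ?_⟩⟩
  · refine Module.End.hasEigenvalue_of_hasEigenvector (x := v) ?_
    refine Module.End.hasEigenvector_iff.2 ⟨Module.End.mem_eigenspace_iff.2 ?_, ?_⟩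
    · rw [Matrix.toLin'_apply, hAv]
    · intro h
      exact (hv 0).ne' (congrFun h 0)
  · intro t ht
    obtain ⟨w, hw⟩ := ht.exists_hasEigenvector
    have hAw : A.mulVec w = t • w := by
      rw [← Matrix.toLin'_apply]
      exact hw.apply_eq_smul
    have hle : ∀ i, t * |w i| ≤ A.mulVec (fun j => |w j|) i := by
      intro i
      calc t * |w i| ≤ |t| * |w i| := mul_le_mul_of_nonneg_right (le_abs_self t) (abs_nonneg _)
        _ = |A.mulVec w i| := by rw [hAw, Pi.smul_apply, smul_eq_mul, abs_mul]
        _ ≤ ∑ j, |A i j * w j| := by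
          simp only [Matrix.mulVec, dotProduct]
          exact Finset.abs_sum_le_sum_abs _ _
        _ = _ := by
          refine Finset.sum_congr rfl fun j _ => ?_
          rw [abs_mul, abs_of_nonneg (hirr.nonneg i j)]
    have h1 : t * (u ⬝ᵥ fun j => |w j|) ≤ lam' * (u ⬝ᵥ fun j => |w j|) := by
      calc t * (u ⬝ᵥ fun j => |w j|) = ∑ i, u i * (t * |w i|) := by
            rw [dotProduct, Finset.mul_sum]
            exact Finset.sum_congr rfl fun i _ => by ring
        _ ≤ u ⬝ᵥ A.mulVec fun j => |w j| :=
            Finset.sum_le_sum fun i _ => mul_le_mul_of_nonneg_left (hle i) (hu i).le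
        _ = _ := by rw [Matrix.dotProduct_mulVec, hAu, smul_dotProduct, smul_eq_mul]
    obtain ⟨j, hj⟩ := Function.ne_iff.1 hw.2
    refine le_of_mul_le_mul_right h1 ?_
    exact Finset.sum_pos' (fun i _ => mul_nonneg (hu i).le (abs_nonneg _))
      ⟨j, Finset.mem_univ j, mul_pos (hu j) (abs_pos.2 hj)⟩
  · rw [Matrix.smul_vecMul, hAu, smul_comm]
  · simp only [Pi.smul_apply, smul_eq_mul, mul_assoc]
    rw [← Finset.mul_sum, inv_mul_cancel₀ huv.ne']

end Perron

/-! ### Existence of the Parry measure -/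

section Existence

variable {s : ℕ} {A : Matrix (Fin s) (Fin s) ℝ} {lam : ℝ} {u v : Fin s → ℝ}

theorem exists_probabilityMeasure_of_weights (q : Fin s → ℝ) (hq : ∀ i, 0 ≤ q i)
    (hq1 : ∑ i, q i = 1) :
    ∃ ν : Measure (Fin s), IsProbabilityMeasure ν ∧ ∀ i, ν {i} = ENNReal.ofReal (q i) := by
  refine ⟨∑ i, ENNReal.ofReal (q i) • Measure.dirac i, ⟨?_⟩, fun i => ?_⟩
  · simp [← ENNReal.ofReal_sum_of_nonneg fun i _ => hq i, hq1]
  · simp [Set.indicator_apply]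

/-- Transition probabilities of the time reversal of the Parry chain. -/
def parryReverse (A : Matrix (Fin s) (Fin s) ℝ) (lam : ℝ) (u v : Fin s → ℝ) (j i : Fin s) : ℝ :=
  parryInit u v i * parryTrans A lam v i j / parryInit u v j

/-- The law of the letter at time `j` given its neighbour `i` closer to time `0`. -/
def twoSidedTrans (A : Matrix (Fin s) (Fin s) ℝ) (lam : ℝ) (u v : Fin s → ℝ) (j : ℤ)
    (i k : Fin s) : ℝ :=
  if j = 0 then parryInit u v k else
    if 0 < j then parryTrans A lam v i k else parryReverse A lam u v i k

/-- The letter of `w` at the neighbour of `j` closer to `0`. -/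
def innerLetter (i₀ : Fin s) (w : ℤ → Fin s) (j : ℤ) : Fin s :=
  if j = 0 then i₀ else w (j - j.sign)

theorem twoSidedTrans_nonneg (hP : IsPerronData A lam u v) (hA : ∀ i j, 0 ≤ A i j)
    (hlam : 0 < lam) (j : ℤ) (i k : Fin s) : 0 ≤ twoSidedTrans A lam u v j i k := by
  unfold twoSidedTrans parryReverse
  split_ifs
  · exact (parryInit_pos hP k).le
  · exact parryTrans_nonneg hP hA hlam i k
  · exact div_nonneg (mul_nonneg (parryInit_pos hP k).le (parryTrans_nonneg hP hA hlam k i))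
      (parryInit_pos hP i).le

theorem sum_twoSidedTrans (hP : IsPerronData A lam u v) (hlam : 0 < lam) (j : ℤ) (i : Fin s) :
    ∑ k, twoSidedTrans A lam u v j i k = 1 := by
  unfold twoSidedTrans parryReverse
  split_ifs
  · simp [parryInit, hP.normalized]
  · exact sum_parryTrans hP hlam i
  · rw [← Finset.sum_div, sum_parryInit_mul_parryTrans hP hlam, div_self (parryInit_pos hP i).ne']

/-- Extending to the left multiplies by the reversed transition p_i p_{ij} / p_j, which cancels the
initial weight p_j and reinstalls p_i one place earlier. -/
theorem prod_twoSidedTrans (hP : IsPerronData A lam u v) (i₀ : Fin s) (w : ℤ → Fin s) (p q : ℕ) :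
    ∏ j ∈ Finset.Icc (-(p : ℤ)) q, twoSidedTrans A lam u v j (innerLetter i₀ w j) (w j) =
      parryWeight A lam u v (fun n => w (n - p)) (p + q) := by
  induction p with
  | zero =>
    induction q with
    | zero => simp [parryWeight, twoSidedTrans]
    | succ q ih =>
      have hI : Finset.Icc (-((0 : ℕ) : ℤ)) ((q + 1 : ℕ) : ℤ) =
          insert ((q : ℤ) + 1) (Finset.Icc (-((0 : ℕ) : ℤ)) q) := by
        ext j
        simp only [Finset.mem_Icc, Finset.mem_insert]
        push_cast
        omega
      rw [hI, Finset.prod_insert (by simp), ih, ← add_assoc, parryWeight, parryWeight,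
        Finset.prod_range_succ]
      have h1 : ((q : ℤ) + 1).sign = 1 := Int.sign_eq_one_of_pos (by omega)
      have h2 : ((q : ℤ) + 1) ≠ 0 := by omega
      have h3 : (0 : ℤ) < (q : ℤ) + 1 := by omega
      simp only [twoSidedTrans, innerLetter, h1, h2, h3, if_true, if_false]
      simp
      ring
  | succ p ih =>
    have hI : Finset.Icc (-((p + 1 : ℕ) : ℤ)) q =
        insert (-(p : ℤ) - 1) (Finset.Icc (-(p : ℤ)) q) := by
      ext j
      simp only [Finset.mem_Icc, Finset.mem_insert]
      push_cast
      omega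
    rw [hI, Finset.prod_insert (by simp), ih, show p + 1 + q = p + q + 1 by ring, parryWeight,
      parryWeight, Finset.prod_range_succ']
    have h1 : (-(p : ℤ) - 1).sign = -1 := Int.sign_eq_neg_one_of_neg (by omega)
    have h2 : (-(p : ℤ) - 1) ≠ 0 := by omega
    have h3 : ¬ (0 : ℤ) < -(p : ℤ) - 1 := by omega
    have h4 : -(p : ℤ) - 1 - -1 = -p := by ring
    have h5 := (parryInit_pos hP (w (-(p : ℤ)))).ne'
    simp only [twoSidedTrans, innerLetter, h1, h2, h3, h4, if_false, parryReverse]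
    have e : ∀ n : ℕ, ((n + 1 : ℕ) : ℤ) - ((p + 1 : ℕ) : ℤ) = n - p := fun n => by
      push_cast; ring
    have e0 : ((0 : ℕ) : ℤ) - ((p + 1 : ℕ) : ℤ) = -p - 1 := by push_cast; ring
    have e1 : ((0 : ℕ) : ℤ) - (p : ℤ) = -p := by simp
    simp only [e, e0, e1]
    field_simp

/-- The path driven by the independent choices `ω (j, i)` of the letter at time `j` given its
neighbour `i` closer to time `0`, on one side of time `0`. -/
def drivenHalfPath (i₀ : Fin s) (ω : ℤ × Fin s → Fin s) (σ : ℤ) : ℕ → Fin s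
  | 0 => ω (0, i₀)
  | n + 1 => ω (σ * (n + 1), drivenHalfPath i₀ ω σ n)

/-- The two-sided path driven by `ω`. -/
def drivenPath (i₀ : Fin s) (ω : ℤ × Fin s → Fin s) (j : ℤ) : Fin s :=
  drivenHalfPath i₀ ω j.sign j.natAbs

/-- The two half paths merge into one recursion outward from time 0; they fit together because the
value at time 0 does not depend on the side. -/
theorem drivenPath_eq (i₀ : Fin s) (ω : ℤ × Fin s → Fin s) (j : ℤ) :
    drivenPath i₀ ω j = ω (j, innerLetter i₀ (drivenPath i₀ ω) j) := by
  have hzero : ∀ σ τ, drivenHalfPath i₀ ω σ 0 = drivenHalfPath i₀ ω τ 0 := fun _ _ => rfl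
  rcases lt_trichotomy j 0 with h | h | h
  · obtain ⟨n, rfl⟩ : ∃ n : ℕ, j = -((n : ℤ) + 1) := ⟨(-j - 1).toNat, by omega⟩
    have h1 : (-((n : ℤ) + 1)).sign = -1 := Int.sign_eq_neg_one_of_neg h
    have h2 : (-((n : ℤ) + 1)).natAbs = n + 1 := by omega
    have h3 : -((n : ℤ) + 1) - -1 = -n := by ring
    simp only [drivenPath, innerLetter, h.ne, if_false, h1, h2, h3, drivenHalfPath]
    congr 2
    · ring
    · rw [Int.natAbs_neg, Int.natAbs_natCast]
      rcases Nat.eq_zero_or_pos n with rfl | hn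
      · exact hzero _ _
      · rw [Int.sign_eq_neg_one_of_neg (by omega)]
  · subst h
    simp [drivenPath, innerLetter, drivenHalfPath]
  · obtain ⟨n, rfl⟩ : ∃ n : ℕ, j = (n : ℤ) + 1 := ⟨(j - 1).toNat, by omega⟩
    have h1 : ((n : ℤ) + 1).sign = 1 := Int.sign_eq_one_of_pos h
    have h2 : ((n : ℤ) + 1).natAbs = n + 1 := by omega
    have h3 : (n : ℤ) + 1 - 1 = n := by ring
    simp only [drivenPath, innerLetter, h.ne', if_false, h1, h2, h3, drivenHalfPath]
    congr 2
    · ring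
    · rw [Int.natAbs_natCast]
      rcases Nat.eq_zero_or_pos n with rfl | hn
      · exact hzero _ _
      · rw [Int.sign_eq_one_of_pos (by omega)]

/-- A window around 0 is closed under moving inward, so by induction on |j| the path in the
recursion may be replaced by w. The event then involves one fixed coordinate of ω for each time. -/
theorem drivenPath_eq_on_iff (i₀ : Fin s) (ω : ℤ × Fin s → Fin s) (w : ℤ → Fin s) (p q : ℕ) :
    (∀ j ∈ Finset.Icc (-(p : ℤ)) q, drivenPath i₀ ω j = w j) ↔
      ∀ j ∈ Finset.Icc (-(p : ℤ)) q, ω (j, innerLetter i₀ w j) = w j := by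
  have hmem : ∀ j ∈ Finset.Icc (-(p : ℤ)) q, j ≠ 0 →
      j - j.sign ∈ Finset.Icc (-(p : ℤ)) q ∧ (j - j.sign).natAbs < j.natAbs := by
    intro j hj hj0
    rw [Finset.mem_Icc] at hj ⊢
    rcases lt_or_gt_of_ne hj0 with h | h
    · rw [Int.sign_eq_neg_one_of_neg h]
      omega
    · rw [Int.sign_eq_one_of_pos h]
      omega
  constructor
  · intro h j hj
    rw [← h j hj, drivenPath_eq]
    congr 2
    unfold innerLetter
    split_ifs with h0
    · rfl
    · exact (h _ (hmem j hj h0).1).symm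
  · intro h
    suffices H : ∀ n : ℕ, ∀ j ∈ Finset.Icc (-(p : ℤ)) q, j.natAbs = n → drivenPath i₀ ω j = w j from
      fun j hj => H _ j hj rfl
    intro n
    induction n using Nat.strong_induction_on with
    | _ n ih =>
      intro j hj hn
      rw [← h j hj, drivenPath_eq]
      congr 2
      unfold innerLetter
      split_ifs with h0
      · rfl
      · exact ih _ (hn ▸ (hmem j hj h0).2) _ (hmem j hj h0).1 rfl

theorem measurable_drivenPath (i₀ : Fin s) :
    Measurable (drivenPath i₀ : (ℤ × Fin s → Fin s) → ℤ → Fin s) := by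
  refine measurable_pi_lambda _ fun j => ?_
  unfold drivenPath
  generalize j.sign = σ
  induction j.natAbs with
  | zero => exact measurable_pi_apply _
  | succ n ih =>
    have happ : Measurable fun p : Fin s × (Fin s → Fin s) => p.2 p.1 := measurable_of_countable _
    exact happ.comp (ih.prodMk (measurable_pi_lambda
      (fun (ω : ℤ × Fin s → Fin s) (i : Fin s) => ω (σ * (n + 1), i))
      fun i => measurable_pi_apply _))

theorem measurableSet_cylinder (l : ℤ) (w : ℕ → Fin s) (k : ℕ) :
    MeasurableSet {x : ℤ → Fin s | ∀ n : ℕ, n ≤ k → x (l + n) = w n} := by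
  simp only [Set.ofPred_forall]
  exact MeasurableSet.iInter fun n => MeasurableSet.iInter fun _ =>
    measurableSet_eq_fun (measurable_pi_apply (l + n)) measurable_const

/-- Push forward a product measure of independent choices. A cylinder around time 0 pulls back to a
box over distinct coordinates, so its mass is the product of transition probabilities. -/
theorem exists_measure_centered_cylinder (hs : 0 < s) (hP : IsPerronData A lam u v)
    (hA : ∀ i j, 0 ≤ A i j) (hlam : 0 < lam) :
    ∃ ν : Measure (ℤ → Fin s), ∀ (w : ℕ → Fin s) (p q : ℕ),
      ν {x | ∀ n : ℕ, n ≤ p + q → x (-(p : ℤ) + n) = w n} =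
        ENNReal.ofReal (parryWeight A lam u v w (p + q)) := by
  let i₀ : Fin s := ⟨0, hs⟩
  choose κ hκ hκw using fun r : ℤ × Fin s =>
    exists_probabilityMeasure_of_weights (twoSidedTrans A lam u v r.1 r.2)
      (twoSidedTrans_nonneg hP hA hlam r.1 r.2) (sum_twoSidedTrans hP hlam r.1 r.2)
  refine ⟨(Measure.infinitePi κ).map (drivenPath i₀), fun w p q => ?_⟩
  rw [Measure.map_apply (measurable_drivenPath i₀) (measurableSet_cylinder _ _ _)]
  let w' : ℤ → Fin s := fun j => w (j + p).toNat
  have hinj : Function.Injective fun j : ℤ => (j, innerLetter i₀ w' j) := fun i j h =>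
    (Prod.ext_iff.1 h).1
  have hset : drivenPath i₀ ⁻¹' {x | ∀ n : ℕ, n ≤ p + q → x (-(p : ℤ) + n) = w n} =
      Set.pi ((Finset.Icc (-(p : ℤ)) q).map ⟨_, hinj⟩) fun r => {w' r.1} := by
    ext ω
    have h1 : ω ∈ Set.pi ((Finset.Icc (-(p : ℤ)) q).map ⟨_, hinj⟩)
        (fun r => ({w' r.1} : Set (Fin s))) ↔
        ∀ j ∈ Finset.Icc (-(p : ℤ)) q, ω (j, innerLetter i₀ w' j) = w' j := by
      simp only [Set.mem_pi, Finset.mem_coe, Finset.mem_map, Function.Embedding.coeFn_mk,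
        Set.mem_singleton_iff]
      constructor
      · exact fun h j hj => h _ ⟨j, hj, rfl⟩
      · rintro h _ ⟨j, hj, rfl⟩
        exact h j hj
    rw [h1, ← drivenPath_eq_on_iff]
    constructor
    · intro h j hj
      rw [Finset.mem_Icc] at hj
      have h2 := h (j + p).toNat (by omega)
      rwa [show -(p : ℤ) + ((j + p).toNat : ℤ) = j by omega] at h2
    · intro h n hn
      have h2 := h (-(p : ℤ) + n) (by rw [Finset.mem_Icc]; omega)
      rw [h2]
      simp [w']
  rw [hset, Measure.infinitePi_pi _ fun _ _ => measurableSet_singleton _, Finset.prod_map]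
  simp only [Function.Embedding.coeFn_mk, hκw]
  rw [← ENNReal.ofReal_prod_of_nonneg fun j _ => twoSidedTrans_nonneg hP hA hlam _ _ _,
    prod_twoSidedTrans hP]
  simp [w']

theorem sum_parryWeight_update (hP : IsPerronData A lam u v) (hlam : 0 < lam) (w : ℕ → Fin s)
    (k : ℕ) : ∑ a, parryWeight A lam u v (Function.update w (k + 1) a) (k + 1) =
      parryWeight A lam u v w k := by
  have h : ∀ a, parryWeight A lam u v (Function.update w (k + 1) a) (k + 1) =
      parryWeight A lam u v w k * parryTrans A lam v (w k) a := by
    intro a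
    have hne : ∀ n ≤ k, Function.update w (k + 1) a n = w n := fun n hn =>
      Function.update_of_ne (by omega) _ _
    rw [parryWeight, parryWeight, Finset.prod_range_succ, ← mul_assoc, hne 0 (Nat.zero_le k),
      hne k le_rfl, Function.update_self]
    congr 2
    refine Finset.prod_congr rfl fun n hn => ?_
    rw [Finset.mem_range] at hn
    rw [hne n hn.le, hne (n + 1) hn]
  simp only [h]
  rw [← Finset.mul_sum, sum_parryTrans hP hlam, mul_one]

/-- Any window is cut out of one containing time 0 by summing out letters: row sums remove them on
the right, stationarity on the left. -/
theorem exists_measure_cylinder (hs : 0 < s) (hP : IsPerronData A lam u v)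
    (hA : ∀ i j, 0 ≤ A i j) (hlam : 0 < lam) :
    ∃ ν : Measure (ℤ → Fin s), ∀ (l : ℤ) (w : ℕ → Fin s) (k : ℕ),
      ν {x | ∀ n : ℕ, n ≤ k → x (l + n) = w n} =
        ENNReal.ofReal (parryWeight A lam u v w k) := by
  obtain ⟨ν, hν⟩ := exists_measure_centered_cylinder hs hP hA hlam
  refine ⟨ν, ?_⟩
  have hnn : ∀ w k, 0 ≤ parryWeight A lam u v w k :=
    IsSymbolicCoding.parryWeight_nonneg hP hA hlam
  let G : ℤ → ℕ → Prop := fun l k => ∀ w : ℕ → Fin s,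
    ν {x | ∀ n : ℕ, n ≤ k → x (l + n) = w n} = ENNReal.ofReal (parryWeight A lam u v w k)
  have hright : ∀ l k, G l (k + 1) → G l k := by
    intro l k h w
    rw [measure_eq_sum_inter_fiber ν (measurable_pi_apply (l + (k + 1 : ℕ))),
      ← sum_parryWeight_update hP hlam w k, ENNReal.ofReal_sum_of_nonneg fun a _ => hnn _ _]
    refine Finset.sum_congr rfl fun a _ => ?_
    rw [← h]
    congr 1
    ext x
    simp only [Set.mem_inter_iff, Set.mem_preimage, Set.mem_singleton_iff, Set.mem_ofPred_eq]
    constructor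
    · rintro ⟨h1, h2⟩ n hn
      rcases Nat.lt_or_eq_of_le hn with h3 | rfl
      · rw [Function.update_of_ne (by omega)]
        exact h2 n (by omega)
      · rw [Function.update_self, h1]
    · intro h1
      refine ⟨by simpa using h1 (k + 1) le_rfl, fun n hn => ?_⟩
      have := h1 n (by omega)
      rwa [Function.update_of_ne (by omega)] at this
  have hleft : ∀ l k, G l (k + 1) → G (l + 1) k := by
    intro l k h w
    rw [measure_eq_sum_inter_fiber ν (measurable_pi_apply l),
      ← sum_parryWeight_cons hP hlam w k, ENNReal.ofReal_sum_of_nonneg fun a _ => hnn _ _]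
    refine Finset.sum_congr rfl fun a _ => ?_
    rw [← h]
    congr 1
    ext x
    simp only [Set.mem_inter_iff, Set.mem_preimage, Set.mem_singleton_iff, Set.mem_ofPred_eq]
    constructor
    · rintro ⟨h1, h2⟩ n hn
      cases n with
      | zero => simpa using h1
      | succ n =>
        have := h2 n (by omega)
        rw [show l + ((n + 1 : ℕ) : ℤ) = l + 1 + n by push_cast; ring]
        exact this
    · intro h1
      refine ⟨by simpa using h1 0 (by omega), fun n hn => ?_⟩
      have := h1 (n + 1) (by omega)
      rw [show l + ((n + 1 : ℕ) : ℤ) = l + 1 + n by push_cast; ring] at this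
      exact this
  have hright' : ∀ (r : ℕ) l k, G l (k + r) → G l k := by
    intro r
    induction r with
    | zero => exact fun _ _ h => h
    | succ r ih => exact fun l k h => ih l k (hright l (k + r) h)
  have hleft' : ∀ (r : ℕ) l k, G l (k + r) → G (l + r) k := by
    intro r
    induction r with
    | zero => intro l k h; simpa using h
    | succ r ih =>
      intro l k h
      have := ih (l + 1) k (hleft l (k + r) h)
      rwa [show l + ((r + 1 : ℕ) : ℤ) = l + 1 + r by push_cast; ring]
  intro l w k
  -- Start at −|l|, drop |l| letters on the right and then l + |l| on the left, which leaves the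
  -- window of k + 1 letters starting at l.
  have h0 : G (-(l.natAbs : ℤ)) (k + (l + l.natAbs).toNat + l.natAbs) := by
    intro w
    rw [add_comm]
    exact hν w _ _
  have h1 := hleft' _ _ _ (hright' _ _ _ h0)
  rw [show -(l.natAbs : ℤ) + ((l + l.natAbs).toNat : ℤ) = l by omega] at h1
  exact h1 w

/-- A forbidden transition has weight zero, so the measure on all sequences is carried by the
subshift and can be restricted to it without changing cylinder masses. -/
theorem exists_isTwoSidedParry (hs : 2 ≤ s) (hA01 : ∀ i j, A i j = 0 ∨ A i j = 1)
    (hirr : A.IsIrreducible) : ∃ m, IsTwoSidedParry A m := by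
  have : NeZero s := ⟨by omega⟩
  obtain ⟨lam, u, v, hP⟩ := exists_isPerronData hirr
  have hlam := perron_eigenvalue_pos hs hirr hP
  obtain ⟨ν, hν⟩ := exists_measure_cylinder (by omega) hP hirr.nonneg hlam
  have hS : MeasurableSet (TwoSidedShift A) := by
    unfold TwoSidedShift
    simp only [Set.ofPred_forall]
    refine MeasurableSet.iInter fun n => ?_
    have hpair : Measurable fun x : ℤ → Fin s => (x n, x (n + 1)) :=
      (measurable_pi_apply n).prodMk (measurable_pi_apply (n + 1))
    exact hpair (Set.toFinite {p : Fin s × Fin s | A p.1 p.2 = 1}).measurableSet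
  have hfull : ∀ᵐ x ∂ν, x ∈ TwoSidedShift A := by
    refine ae_all_iff.2 fun n => ?_
    rw [ae_iff]
    have hsub : {x : ℤ → Fin s | ¬ A (x n) (x (n + 1)) = 1} ⊆
        ⋃ (i : Fin s) (j : Fin s) (_ : A i j ≠ 1),
          {x | ∀ r : ℕ, r ≤ 1 → x (n + r) = if r = 0 then i else j} := by
      intro x hx
      simp only [Set.mem_iUnion]
      refine ⟨x n, x (n + 1), hx, fun r hr => ?_⟩
      interval_cases r <;> simp
    refine measure_mono_null hsub ?_
    refine measure_iUnion_null fun i => measure_iUnion_null fun j => measure_iUnion_null fun h => ?_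
    rw [hν n (fun r => if r = 0 then i else j) 1]
    simp [parryWeight, parryTrans, (hA01 i j).resolve_right h]
  refine ⟨ν.comap Subtype.val, lam, u, v, hP, fun l w k => ?_⟩
  rw [comap_subtype_coe_apply hS, ← hν l w k]
  refine measure_congr ?_
  filter_upwards [hfull] with x hx
  refine propext ⟨?_, fun h => ⟨⟨x, hx⟩, h, rfl⟩⟩
  rintro ⟨y, hy, rfl⟩
  exact hy

/-- Project the two-sided measure to the nonnegative coordinates. -/
theorem exists_isOneSidedParry (hs : 2 ≤ s) (hA01 : ∀ i j, A i j = 0 ∨ A i j = 1)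
    (hirr : A.IsIrreducible) : ∃ m, IsOneSidedParry A m := by
  obtain ⟨m, lam, u, v, hP, hm⟩ := exists_isTwoSidedParry hs hA01 hirr
  let φ : TwoSidedShift A → OneSidedShift A := fun x =>
    ⟨fun n => x.1 n, fun n => by simpa using x.2 n⟩
  have hφ : Measurable φ := Measurable.subtype_mk (measurable_pi_lambda
    (fun (x : TwoSidedShift A) (n : ℕ) => x.1 n)
    fun n => (measurable_pi_apply (n : ℤ)).comp measurable_subtype_coe)
  refine ⟨m.map φ, lam, u, v, hP, fun w k => ?_⟩
  rw [Measure.map_apply hφ]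
  · rw [← hm 0 w k]
    congr 1
    ext x
    simp [φ]
  · simp only [Set.ofPred_forall]
    exact MeasurableSet.iInter fun n => MeasurableSet.iInter fun _ =>
      measurableSet_eq_fun ((measurable_pi_apply n).comp measurable_subtype_coe) measurable_const

end Existence

/-! ### The subshifts as symbolic codings -/

section Subshifts

variable {s : ℕ} (A : Matrix (Fin s) (Fin s) ℝ)

theorem oneSidedShiftMap_iterate (x : OneSidedShift A) (i j : ℕ) :
    ((oneSidedShiftMap A)^[i] x).1 j = x.1 (j + i) := by
  induction i generalizing x with
  | zero => rfl
  | succ i ih =>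
    rw [Function.iterate_succ_apply, ih]
    change x.1 (j + i + 1) = _
    rw [add_assoc]

theorem twoSidedShiftMap_iterate (x : TwoSidedShift A) (i : ℕ) (j : ℤ) :
    ((twoSidedShiftMap A)^[i] x).1 j = x.1 (j + i) := by
  induction i generalizing x with
  | zero => simp
  | succ i ih =>
    rw [Function.iterate_succ_apply, ih]
    change x.1 (j + i + 1) = _
    rw [add_assoc, Nat.cast_succ]

theorem isSymbolicCoding_oneSided :
    IsSymbolicCoding A (oneSidedShiftMap A) (oneSidedAgree A) (fun _ x => x.1 0) fun n => n where
  measurable_map := Measurable.subtype_mk (measurable_pi_lambda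
    (fun (x : OneSidedShift A) (n : ℕ) => x.1 (n + 1))
    fun n => (measurable_pi_apply (n + 1)).comp measurable_subtype_coe)
  measurable_letter _ := (measurable_pi_apply 0).comp measurable_subtype_coe
  exists_shift _ := ⟨0, fun _ => rfl⟩
  agree_iff n x y := by
    simp [partitionJoin_eq_iff, oneSidedShiftMap_iterate, oneSidedAgree]
  length_zero := rfl
  length_le n := by omega
  agree_of_succ n x y h i hi := h i (by omega)
  eq_of_agree x y h := Subtype.ext (funext fun i => h (i + 1) i (by omega))
  le_generate := by
    change MeasurableSpace.comap Subtype.val _ ≤ _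
    rw [← measurable_iff_comap_le]
    refine @measurable_pi_lambda _ _ _ (_) _ _ fun i => ?_
    have h : (fun x : OneSidedShift A => x.1 i) = (fun w : Fin (i + 1) → Fin s => w (Fin.last i)) ∘
        partitionJoin (oneSidedShiftMap A) (fun x => x.1 0) (i + 1) := by
      funext x
      simp [partitionJoin, oneSidedShiftMap_iterate]
    rw [h]
    exact ((measurable_pi_apply (Fin.last i)).comp (comap_measurable _)).mono
      (le_iSup (fun n => MeasurableSpace.comap
        (partitionJoin (oneSidedShiftMap A) (fun x => x.1 0) n) inferInstance) (i + 1)) le_rfl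
  admissible x := x.2 0

/-- The coordinates |i| < n form a word of 2n − 1 letters starting at 1 − n; truncated subtraction
gives length 0 at n = 0, as required. -/
theorem isSymbolicCoding_twoSided :
    IsSymbolicCoding A (twoSidedShiftMap A) (twoSidedAgree A) (fun n x => x.1 (1 - n))
      fun n => 2 * n - 1 where
  measurable_map := Measurable.subtype_mk (measurable_pi_lambda
    (fun (x : TwoSidedShift A) (n : ℤ) => x.1 (n + 1))
    fun n => (measurable_pi_apply (n + 1)).comp measurable_subtype_coe)
  measurable_letter n := (measurable_pi_apply (1 - (n : ℤ))).comp measurable_subtype_coe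
  exists_shift n := ⟨n, fun x => by simp [twoSidedShiftMap_iterate]⟩
  agree_iff n x y := by
    simp only [partitionJoin_eq_iff, twoSidedShiftMap_iterate, twoSidedAgree]
    constructor
    · intro h i hi
      exact h _ (by rw [abs_lt]; omega)
    · intro h i hi
      rw [abs_lt] at hi
      have := h (i + n - 1).toNat (by omega)
      rwa [show 1 - (n : ℤ) + ((i + n - 1).toNat : ℤ) = i by omega] at this
  length_zero := rfl
  length_le n := by omega
  agree_of_succ n x y h i hi := h i (by push_cast; omega)
  eq_of_agree x y h := Subtype.ext (funext fun i => h (i.natAbs + 1) i (by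
    rw [abs_lt]; omega))
  le_generate := by
    change MeasurableSpace.comap Subtype.val _ ≤ _
    rw [← measurable_iff_comap_le]
    refine @measurable_pi_lambda _ _ _ (_) _ _ fun i => ?_
    let N := i.natAbs + 1
    let r : Fin (2 * N - 1) := ⟨(i + N - 1).toNat, by omega⟩
    have h : (fun x : TwoSidedShift A => x.1 i) = (fun w : Fin (2 * N - 1) → Fin s => w r) ∘
        partitionJoin (twoSidedShiftMap A) (fun x => x.1 (1 - (N : ℤ))) (2 * N - 1) := by
      funext x
      simp only [partitionJoin, twoSidedShiftMap_iterate, Function.comp_apply, r]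
      exact congrArg x.1 (by omega)
    rw [h]
    exact ((measurable_pi_apply r).comp (comap_measurable _)).mono
      (le_iSup (fun n : ℕ => MeasurableSpace.comap
        (partitionJoin (twoSidedShiftMap A) (fun x => x.1 (1 - (n : ℤ))) (2 * n - 1))
        inferInstance) N) le_rfl
  admissible x := x.2 _

end Subshifts

end

theorem theorem1p1 (s : ℕ) (hs : 2 ≤ s) (A : Matrix (Fin s) (Fin s) ℝ)
    (hA01 : ∀ i j, A i j = 0 ∨ A i j = 1) (hirr : A.IsIrreducible) (haper : IsAperiodicMatrix A)
    (θ : ℝ) (hθ : 1 < θ) :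
    (∃ c : ℝ, 0 < c ∧ ∀ μ : Measure (OneSidedShift A), IsProbabilityMeasure μ →
      MeasurePreserving (oneSidedShiftMap A) μ μ →
      ∀ f : OneSidedShift A → ℝ, IsSymbolicLipschitz (oneSidedAgree A) θ f →
        |∫ x, f x ∂μ - ∫ x, f x ∂(oneSidedParry A)| ≤
          c * symbolicSeminorm (oneSidedAgree A) θ f *
            Real.sqrt ((measureEntropy (oneSidedShiftMap A) (oneSidedParry A)).toReal -
              (measureEntropy (oneSidedShiftMap A) μ).toReal)) ∧
    (∃ c : ℝ, 0 < c ∧ ∀ μ : Measure (TwoSidedShift A), IsProbabilityMeasure μ →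
      MeasurePreserving (twoSidedShiftMap A) μ μ →
      ∀ f : TwoSidedShift A → ℝ, IsSymbolicLipschitz (twoSidedAgree A) θ f →
        |∫ x, f x ∂μ - ∫ x, f x ∂(twoSidedParry A)| ≤
          c * symbolicSeminorm (twoSidedAgree A) θ f *
            Real.sqrt ((measureEntropy (twoSidedShiftMap A) (twoSidedParry A)).toReal -
              (measureEntropy (twoSidedShiftMap A) μ).toReal)) := by
  have : NeZero s := ⟨by omega⟩
  constructor
  · have hex := exists_isOneSidedParry hs hA01 hirr
    -- Existence rules out the default measure 0. The eigenvectors attached to the chosen measure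
    -- are whatever its defining property supplies, and the argument works for any such choice.
    have hpar : IsOneSidedParry A (oneSidedParry A) := by
      rw [oneSidedParry, dif_pos hex]
      exact hex.choose_spec
    obtain ⟨lam, u, v, hP, hm⟩ := hpar
    refine (isSymbolicCoding_oneSided A).exists_abs_integral_sub_parry_le hirr hP
      (perron_eigenvalue_pos hs hirr hP) (fun n w k => ?_) hθ
    rw [← hm w k]
    simp [oneSidedShiftMap_iterate]
  · have hex := exists_isTwoSidedParry hs hA01 hirr
    have hpar : IsTwoSidedParry A (twoSidedParry A) := by
      rw [twoSidedParry, dif_pos hex]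
      exact hex.choose_spec
    obtain ⟨lam, u, v, hP, hm⟩ := hpar
    refine (isSymbolicCoding_twoSided A).exists_abs_integral_sub_parry_le hirr hP
      (perron_eigenvalue_pos hs hirr hP) (fun n w k => ?_) hθ
    rw [← hm (1 - (n : ℤ)) w k]
    simp [twoSidedShiftMap_iterate]
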